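/- Let $\omega=e^{2\pi i/3}$, $\mu_\pm=\tfrac{-1\pm\sqrt5}{2}$, and let $\Sigma(360\varphi)\subset \mathrm U(3)$ be the group generated by $$\begin{pmatrix}0&1&0\\0&0&1\\1&0&0\end{pmatrix},\quad \begin{pmatrix}1&0&0\\0&-1&0\\0&0&-1\end{pmatrix},\quad \tfrac12\begin{pmatrix}-1&\mu_-&\mu_+\\ \mu_-&\mu_+&-1\\ \mu_+&-1&\mu_-\end{pmatrix},\quad \begin{pmatrix}-1&0&0\\0&0&-\omega\\0&-\omega^2&0\end{pmatrix}.$$ Then $\Sigma(360\varphi)$ is a perfect group of order $1080$ contained in $\mathrm{SU}(3)$. Its fundamental representation $f=\chi_2$ (the inclusion in $\mathrm U(3)$) is irreducible, and it has two further $3$-dimensional unitary irreducible representations $\chi_3,\chi_4$. Writing $\zeta_k=e^{2\pi i/k}$, the characters of $\chi_2,\chi_3,\chi_4$ are given on the 17 conjugacy classes by the following rows of the character table: * $\chi_2$: $3,\ 3\zeta_3^2,\ 3\zeta_3,\ -1,\ -\zeta_3^2,\ -\zeta_3,\ 0,\ 0,\ 1,\ \zeta_3^2,\ \zeta_3,\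 -\zeta_{15}^8-\zeta_{15}^2,\ -\zeta_5^4-\zeta_5,\ -\zeta_{15}^{13}-\zeta_{15}^7,\ -\zeta_{15}^4-\zeta_{15},\ -\zeta_{15}^{14}-\zeta_{15}^{11},\ -\zeta_5^3-\zeta_5^2$; * $\chi_3$: $3,\ 3\zeta_3^2,\ 3\zeta_3,\ -1,\ -\zeta_3^2,\ -\zeta_3,\ 0,\ 0,\ 1,\ \zeta_3^2,\ \zeta_3,\ -\zeta_{15}^{14}-\zeta_{15}^{11},\ -\zeta_5^3-\zeta_5^2,\ -\zeta_{15}^4-\zeta_{15},\ -\zeta_{15}^{13}-\zeta_{15}^7,\ -\zeta_{15}^8-\zeta_{15}^2,\ -\zeta_5^4-\zeta_5$; * $\chi_4$: $3,\ 3\zeta_3,\ 3\zeta_3^2,\ -1,\ -\zeta_3,\ -\zeta_3^2,\ 0,\ 0,\ 1,\ \zeta_3,\ \zeta_3^2,\ -\zeta_{15}^4-\zeta_{15},\ -\zeta_5^3-\zeta_5^2,\ -\zeta_{15}^{14}-\zeta_{15}^{11},\ -\zeta_{15}^8-\zeta_{15}^2,\ -\zeta_{15}^{13}-\zeta_{15}^7,\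 -\zeta_5^4-\zeta_5$. For an irreducible representation $\lambda$ of a finite subgroup $G\subset\mathrm U(q)$, call $G$ a $\lambda$-twisted unitary $t$-group if $$\frac1{|G|}\sum_{g\in G}|\mathrm{tr}\,\lambda(g)|^2\,(g\otimes \bar g)^{\otimes t}=\int_{\mathrm U(q)}(U\otimes\bar U)^{\otimes t}\,dU$$ (normalized Haar measure). A subspace $C\subset(\mathbb C^q)^{\otimes n}$ transforms in $\lambda$ if it is invariant under all $g^{\otimes n}$, $g\in G$, and the resulting representation of $G$ on $C$ is isomorphic to $\lambda$. A code $C$ has distance at least $t+1$ if for every operator $E$ acting nontrivially on at most $t$ qudits there is $c_E\in\mathbb C$ with $\langle\psi|E|\phi\rangle=c_E\langle\psi|\phi\rangle$ for all $\psi,\phi\in C$. 1. $\Sigma(360\varphi)$ is both a $\chi_3$-twisted and a $\chi_4$-twisted unitary $1$-group. 2. For every $n$ and $\lambda\in\{\chi_3,\chi_4\}$, every subspace $C\subset(\mathbb C^3)^{\otimes n}$ that transforms in $\lambda$ is a $3$-dimensional (one-qutrit) code of distance at least $2$. In a suitable orthonormal logical basis of $C$, each $g^{\otimes n}$, $g\in\Sigma(360\varphi)$,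 implements the logical gate $\lambda(g)$. Moreover, in a suitable orthonormal logical basis, every gate of $\Sigma(360\varphi)\subset \mathrm U(3)$ is implemented by a transversal gate $g^{\otimes n}$ with $g\in\Sigma(360\varphi)$. 3. A subspace of $(\mathbb C^3)^{\otimes n}$ transforming in $\chi_3$ exists if and only if $n\equiv1\pmod 3$ and $n\ge7$; one transforming in $\chi_4$ exists if and only if $n\equiv2\pmod3$ and $n\ge5$. 4. The $5$-qutrit code is unique: exactly one subspace of $(\mathbb C^3)^{\otimes5}$ transforms in $\chi_4$. -/

import Mathlib

open Matrix MeasureTheory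

noncomputable section

/-! ### Unitary groups, Haar measure, and unitary matrix representations -/

instance compactSpace_unitaryGroup (q : ℕ) : CompactSpace (unitaryGroup (Fin q) ℂ) := by
  have hsub : ((unitaryGroup (Fin q) ℂ : Submonoid (Matrix (Fin q) (Fin q) ℂ)) :
      Set (Matrix (Fin q) (Fin q) ℂ)) ⊆
      Set.pi Set.univ fun _ : Fin q => Set.pi Set.univ fun _ : Fin q =>
        Metric.closedBall (0 : ℂ) 1 := by
    intro U hU i _ j _
    simpa using entry_norm_bound_of_unitary hU i j
  have hclosed : IsClosed ((unitaryGroup (Fin q) ℂ : Submonoid (Matrix (Fin q) (Fin q) ℂ)) :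
      Set (Matrix (Fin q) (Fin q) ℂ)) := by
    have : ((unitaryGroup (Fin q) ℂ : Submonoid (Matrix (Fin q) (Fin q) ℂ)) :
        Set (Matrix (Fin q) (Fin q) ℂ)) = {U | star U * U = 1} := by
      ext U
      exact mem_unitaryGroup_iff'
    rw [this]
    exact isClosed_eq (continuous_star.mul continuous_id) continuous_const
  have hball : IsCompact (Set.pi Set.univ fun _ : Fin q => Set.pi Set.univ fun _ : Fin q =>
      Metric.closedBall (0 : ℂ) 1) :=
    isCompact_univ_pi fun _ => isCompact_univ_pi fun _ => isCompact_closedBall 0 1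
  exact isCompact_iff_compactSpace.mp (IsCompact.of_isClosed_subset hball hclosed hsub)

instance measurableSpace_unitaryGroup (q : ℕ) : MeasurableSpace (unitaryGroup (Fin q) ℂ) :=
  borel _

instance borelSpace_unitaryGroup (q : ℕ) : BorelSpace (unitaryGroup (Fin q) ℂ) := ⟨rfl⟩

/-- The Haar measure on `U(q)`, normalized to total mass one. -/
def unitaryHaar (q : ℕ) : Measure (unitaryGroup (Fin q) ℂ) :=
  Measure.haarMeasure ⊤

/-- The linear operator on `ℂ^ι` (Euclidean norm) with matrix `A`. -/
abbrev matOp {ι : Type*} [Fintype ι] [DecidableEq ι] (A : Matrix ι ι ℂ) :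
    EuclideanSpace ℂ ι →ₗ[ℂ] EuclideanSpace ℂ ι :=
  Matrix.toEuclideanLin A

/-- A homomorphism `G → U(m)` regarded as a representation of `G` on `ℂ^m`. -/
def unitaryRep {G : Type*} [Group G] {m : ℕ} (lam : G →* unitaryGroup (Fin m) ℂ) :
    Representation ℂ G (EuclideanSpace ℂ (Fin m)) where
  toFun g := matOp (lam g).1
  map_one' := by
    ext v i
    simp
  map_mul' g h := by
    ext v i
    simp [Matrix.mulVec_mulVec]

/-- The character of a unitary matrix representation. -/
def unitaryChar {G : Type*} [Group G] {m : ℕ} (lam : G →* unitaryGroup (Fin m) ℂ) (g : G) : ℂ :=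
  (lam g).1.trace

/-! ### Twisted unitary `t`-groups -/

/-- The matrix `(U ⊗ U*)^{⊗ t}`, where `U*` is the entrywise complex conjugate of `U`. -/
def balancedPower {q : ℕ} (t : ℕ) (U : Matrix (Fin q) (Fin q) ℂ) :
    Matrix (Fin t → Fin q × Fin q) (Fin t → Fin q × Fin q) ℂ :=
  Matrix.of fun x y => ∏ k, U (x k).1 (y k).1 * star (U (x k).2 (y k).2)

/-- The finite subgroup `G` of `U(q)` is a unitary `t`-group twisted by `lam`: the average of
`(U ⊗ U*)^{⊗ t}` over `G` with weight `|tr lam(g)|² / |G|` equals its Haar average over `U(q)`.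
(The notion is meant for irreducible `lam`; the matrix equation is written entrywise.) -/
def IsTwistedUnitaryGroup {q m : ℕ} (t : ℕ) (G : Subgroup (unitaryGroup (Fin q) ℂ))
    (lam : G →* unitaryGroup (Fin m) ℂ) : Prop :=
  Finite G ∧ ∀ x y : Fin t → Fin q × Fin q,
    ∑ᶠ g : G, ((‖unitaryChar lam g‖ ^ 2 / (Nat.card G : ℝ) : ℝ) : ℂ) *
        balancedPower t g.1.1 x y =
      ∫ U : unitaryGroup (Fin q) ℂ, balancedPower t U.1 x y ∂(unitaryHaar q)

/-! ### Qudit codes -/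

/-- The state space `(ℂ^q)^{⊗ n}` of `n` qudits, with orthonormal computational basis indexed by
the words `Fin n → Fin q`. -/
abbrev QuditSpace (q n : ℕ) : Type := EuclideanSpace ℂ (Fin n → Fin q)

/-- The transversal physical gate `u 0 ⊗ ⋯ ⊗ u (n - 1)`. -/
def tensorGate {q n : ℕ} (u : Fin n → unitaryGroup (Fin q) ℂ) :
    QuditSpace q n →ₗ[ℂ] QuditSpace q n :=
  matOp (Matrix.of fun x y => ∏ i, (u i).1 (x i) (y i))

/-- The physical gate `U^{⊗ n}`. -/
def gatePower {q : ℕ} (n : ℕ) (U : unitaryGroup (Fin q) ℂ) :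
    QuditSpace q n →ₗ[ℂ] QuditSpace q n :=
  tensorGate fun _ => U

/-- The error that acts on the qudits in `S` by the operator with matrix `A` and on all other
qudits as the identity. -/
def localError {q n : ℕ} (S : Finset (Fin n)) (A : Matrix (S → Fin q) (S → Fin q) ℂ) :
    QuditSpace q n →ₗ[ℂ] QuditSpace q n :=
  matOp (Matrix.of fun x y =>
    if ∀ i, i ∉ S → x i = y i then A (fun i => x i) (fun i => y i) else 0)

/-- The Knill-Laflamme conditions for all errors of weight at most `t`; that is, the code `C` has
distance at least `t + 1`. -/
def DetectsErrors {q n : ℕ} (C : Submodule ℂ (QuditSpace q n)) (t : ℕ) : Prop :=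
  ∀ (S : Finset (Fin n)) (A : Matrix (S → Fin q) (S → Fin q) ℂ), S.card ≤ t →
    ∃ c : ℂ, ∀ ψ ∈ C, ∀ φ ∈ C, inner ℂ ψ (localError S A φ) = c * inner ℂ ψ φ

/-- The code `C` transforms in `lam`: it is a subrepresentation of `g ↦ g^{⊗ n}` that is
isomorphic to `lam`. -/
def TransformsIn {q m n : ℕ} {G : Subgroup (unitaryGroup (Fin q) ℂ)}
    (lam : G →* unitaryGroup (Fin m) ℂ) (C : Submodule ℂ (QuditSpace q n)) : Prop :=
  ∃ e : EuclideanSpace ℂ (Fin m) ≃ₗ[ℂ] C, ∀ (g : G) (v : EuclideanSpace ℂ (Fin m)),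
    (e (unitaryRep lam g v) : QuditSpace q n) = gatePower n g.1 (e v : QuditSpace q n)

/-- With logical basis given by the isometric encoding `V`, the physical gate `P` implements the
logical gate `L`. -/
def Implements {q m n : ℕ} (V : EuclideanSpace ℂ (Fin m) →ₗᵢ[ℂ] QuditSpace q n)
    (P : QuditSpace q n →ₗ[ℂ] QuditSpace q n) (L : unitaryGroup (Fin m) ℂ) : Prop :=
  ∀ v, P (V v) = V (matOp L.1 v)

/-- `C` is an `m`-dimensional code of distance at least `t + 1`, in a suitable logical basis
`g^{⊗ n}` implements the logical gate `lam g` for every `g` in `G`. -/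
structure IsTwistedCode {q m n : ℕ} (t : ℕ) {G : Subgroup (unitaryGroup (Fin q) ℂ)}
    (lam : G →* unitaryGroup (Fin m) ℂ) (C : Submodule ℂ (QuditSpace q n)) : Prop where
  finrank_eq : Module.finrank ℂ C = m
  detects : DetectsErrors C t
  implements : ∃ V : EuclideanSpace ℂ (Fin m) →ₗᵢ[ℂ] QuditSpace q n,
    LinearMap.range V.toLinearMap = C ∧ ∀ g : G, Implements V (gatePower n g.1) (lam g)

/-- In a suitable logical basis of the `q`-dimensional code `C`, every gate in `G ⊆ U(q)` is
implemented by a physical gate `g^{⊗ n}` with `g ∈ G`. -/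
def HasTransversalGroup {q n : ℕ} (G : Subgroup (unitaryGroup (Fin q) ℂ))
    (C : Submodule ℂ (QuditSpace q n)) : Prop :=
  ∃ V : EuclideanSpace ℂ (Fin q) →ₗᵢ[ℂ] QuditSpace q n,
    LinearMap.range V.toLinearMap = C ∧
      ∀ L ∈ G, ∃ g ∈ G, Implements V (gatePower n g) L

/-! ### The group `Σ(360φ)` -/

/-- `zeta k = exp(2πi/k)`. -/
def zeta (k : ℕ) : ℂ := Complex.exp (2 * Real.pi * Complex.I / k)

lemma zeta3_sq_add : zeta 3 ^ 2 + zeta 3 + 1 = 0 := by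
  have h := (Complex.isPrimitiveRoot_exp 3 (by norm_num)).geom_sum_eq_zero (by norm_num)
  simp only [Finset.sum_range_succ, Finset.sum_range_zero, pow_zero, pow_one, zero_add] at h
  have hz : zeta 3 = Complex.exp (2 * Real.pi * Complex.I / (3 : ℕ)) := rfl
  rw [← hz] at h
  linear_combination h

lemma star_zeta3 : star (zeta 3) = zeta 3 ^ 2 := by
  have h3 : zeta 3 ^ 3 = 1 := by linear_combination (zeta 3 - 1) * zeta3_sq_add
  have hn : ‖zeta 3‖ = 1 := by
    have : ‖zeta 3‖ ^ 3 = 1 := by rw [← norm_pow, h3, norm_one]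
    exact (pow_eq_one_iff_of_nonneg (norm_nonneg _) (by norm_num)).mp this
  have h1 : zeta 3 * star (zeta 3) = 1 := by
    have := Complex.mul_conj' (zeta 3)
    rw [hn] at this
    simpa using this
  calc star (zeta 3) = zeta 3 ^ 3 * star (zeta 3) := by rw [h3, one_mul]
    _ = zeta 3 ^ 2 * (zeta 3 * star (zeta 3)) := by ring
    _ = zeta 3 ^ 2 := by rw [h1, mul_one]

/-- `(√5 - 1) / 2` -/
def muPlus : ℂ := (((-1 + √5) / 2 : ℝ) : ℂ)

/-- `(-√5 - 1) / 2` -/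
def muMinus : ℂ := (((-1 - √5) / 2 : ℝ) : ℂ)

lemma muPlus_add_muMinus : muPlus + muMinus = -1 := by
  simp only [muPlus, muMinus]
  push_cast
  ring

lemma muPlus_mul_muMinus : muPlus * muMinus = -1 := by
  have h : (√5 : ℝ) ^ 2 = 5 := Real.sq_sqrt (by norm_num)
  simp only [muPlus, muMinus, ← Complex.ofReal_mul]
  rw [show ((-1 + √5) / 2 * ((-1 - √5) / 2) : ℝ) = -1 by linear_combination (-1 / 4) * h]
  simp

lemma star_muPlus : star muPlus = muPlus := Complex.conj_ofReal _

lemma star_muMinus : star muMinus = muMinus := Complex.conj_ofReal _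

/-- Cyclic permutation matrix. -/
def genA : Matrix (Fin 3) (Fin 3) ℂ := !![0, 1, 0; 0, 0, 1; 1, 0, 0]

/-- Diagonal sign matrix. -/
def genE : Matrix (Fin 3) (Fin 3) ℂ := !![1, 0, 0; 0, -1, 0; 0, 0, -1]

/-- An involution which generates together with `genA` and `genE` the icosahedral group. -/
def genW : Matrix (Fin 3) (Fin 3) ℂ :=
  (1 / 2 : ℂ) • !![-1, muMinus, muPlus; muMinus, muPlus, -1; muPlus, -1, muMinus]

/-- The further generator of `Σ(360φ)`. -/
def genZ : Matrix (Fin 3) (Fin 3) ℂ :=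
  !![-1, 0, 0; 0, 0, -zeta 3; 0, -zeta 3 ^ 2, 0]

lemma genA_mem : genA ∈ unitaryGroup (Fin 3) ℂ := by
  rw [mem_unitaryGroup_iff]
  ext i j
  fin_cases i <;> fin_cases j <;>
    simp [genA, Matrix.mul_apply, Fin.sum_univ_three, Matrix.star_apply]

lemma genE_mem : genE ∈ unitaryGroup (Fin 3) ℂ := by
  rw [mem_unitaryGroup_iff]
  ext i j
  fin_cases i <;> fin_cases j <;>
    simp [genE, Matrix.mul_apply, Fin.sum_univ_three, Matrix.star_apply]

lemma genW_mem : genW ∈ unitaryGroup (Fin 3) ℂ := by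
  have h1 := muPlus_add_muMinus
  have h2 := muPlus_mul_muMinus
  have hs : muPlus ^ 2 + muMinus ^ 2 = 3 := by
    linear_combination (muPlus + muMinus - 1) * h1 - 2 * h2
  have e1 : (starRingEnd ℂ) muPlus = muPlus := star_muPlus
  have e2 : (starRingEnd ℂ) muMinus = muMinus := star_muMinus
  have e3 : (starRingEnd ℂ) 2 = 2 := map_ofNat _ 2
  rw [mem_unitaryGroup_iff]
  ext i j
  fin_cases i <;> fin_cases j <;>
    simp [genW, Matrix.mul_apply, Fin.sum_univ_three, Matrix.star_apply, e1, e2, e3] <;>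
    first
      | linear_combination (1 / 4) * hs
      | linear_combination (1 / 4) * h2 - (1 / 4) * h1

lemma genZ_mem : genZ ∈ unitaryGroup (Fin 3) ℂ := by
  have h3 : zeta 3 ^ 3 = 1 := by linear_combination (zeta 3 - 1) * zeta3_sq_add
  have e : (starRingEnd ℂ) (zeta 3) = zeta 3 ^ 2 := star_zeta3
  rw [mem_unitaryGroup_iff]
  ext i j
  fin_cases i <;> fin_cases j <;>
    simp [genZ, Matrix.mul_apply, Fin.sum_univ_three, Matrix.star_apply, e] <;>
    first
      | linear_combination h3
      | linear_combination (zeta 3 ^ 3 + 1) * h3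

/-- The group `Σ(360φ)` (the Valentiner group, a triple cover of `A₆`), as a group of unitary
`3 × 3` matrices given by its standard generators. -/
def sigma360 : Subgroup (unitaryGroup (Fin 3) ℂ) :=
  Subgroup.closure {⟨genA, genA_mem⟩, ⟨genE, genE_mem⟩, ⟨genW, genW_mem⟩, ⟨genZ, genZ_mem⟩}

/-- The fundamental (defining) representation of `Σ(360φ)`. -/
def fundamentalRep : sigma360 →* unitaryGroup (Fin 3) ℂ := sigma360.subtype

/-! ### Rows of the character table -/

/-- The irreducible character `χ₂` on the 17 conjugacy classes of `Σ(360φ)`, which have sizes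
`1, 1, 1, 45, 45, 45, 120, 120, 90, 90, 90, 72, 72, 72, 72, 72, 72`. -/
def chi2 : Fin 17 → ℂ :=
  ![3, 3 * zeta 3 ^ 2, 3 * zeta 3, -1, -zeta 3 ^ 2, -zeta 3, 0, 0, 1, zeta 3 ^ 2, zeta 3,
    -zeta 15 ^ 8 - zeta 15 ^ 2, -zeta 5 ^ 4 - zeta 5, -zeta 15 ^ 13 - zeta 15 ^ 7,
    -zeta 15 ^ 4 - zeta 15, -zeta 15 ^ 14 - zeta 15 ^ 11, -zeta 5 ^ 3 - zeta 5 ^ 2]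

/-- The irreducible character `χ₃`, on the same classes. -/
def chi3 : Fin 17 → ℂ :=
  ![3, 3 * zeta 3 ^ 2, 3 * zeta 3, -1, -zeta 3 ^ 2, -zeta 3, 0, 0, 1, zeta 3 ^ 2, zeta 3,
    -zeta 15 ^ 14 - zeta 15 ^ 11, -zeta 5 ^ 3 - zeta 5 ^ 2, -zeta 15 ^ 4 - zeta 15,
    -zeta 15 ^ 13 - zeta 15 ^ 7, -zeta 15 ^ 8 - zeta 15 ^ 2, -zeta 5 ^ 4 - zeta 5]

/-- The irreducible character `χ₄`, on the same classes. -/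
def chi4 : Fin 17 → ℂ :=
  ![3, 3 * zeta 3, 3 * zeta 3 ^ 2, -1, -zeta 3, -zeta 3 ^ 2, 0, 0, 1, zeta 3, zeta 3 ^ 2,
    -zeta 15 ^ 4 - zeta 15, -zeta 5 ^ 3 - zeta 5 ^ 2, -zeta 15 ^ 14 - zeta 15 ^ 11,
    -zeta 15 ^ 8 - zeta 15 ^ 2, -zeta 15 ^ 13 - zeta 15 ^ 7, -zeta 5 ^ 4 - zeta 5]

/-- The representations `f`, `lam₃`, `lam₄` of `Σ(360φ)` have characters `χ₂`, `χ₃`, `χ₄`, where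
`c g` is the column of the table to which `g` belongs. The value of `χ₂` determines the column,
except for the two columns with `χ₂ = χ₃ = χ₄ = 0`; so the characters are pinned down. -/
def HaveCharacters (f lam₃ lam₄ : sigma360 →* unitaryGroup (Fin 3) ℂ) : Prop :=
  ∃ c : sigma360 → Fin 17, ∀ g,
    unitaryChar f g = chi2 (c g) ∧ unitaryChar lam₃ g = chi3 (c g) ∧
      unitaryChar lam₄ g = chi4 (c g)

end

/-! Twice each matrix of the group has entries in ℤ[μ, ω], which embeds in ℂ (`toComplex_injective`)
and has decidable equality. The group can therefore be listed: the monomial matrices in it form a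
subgroup of order 3·4·6 = 72 with 15 right cosets, and `cosetTable` records how the generators move
these cosets. Closure under right multiplication by generators, reachability of every listed matrix
and distinctness of the list give order 1080 (`elt_bijective`). Determinants, perfectness and
characters become finite computations in ℤ[μ, ω].

The two other representations are Galois conjugates of the fundamental one: apply √5 ↦ -√5 to all
entries for `lam3`, and complex conjugation as well for `lam4`. Already the integral generators
`genA` and `genE`, which no Galois conjugation changes, act irreducibly.

The heart is the identity Σ |χ₂|²|χ₃|² = |G| (`sum_chiInt`), where also |χ₄| = |χ₃|. The adjoint
representations of f and λ then share only the trivial constituent, so every equivariant linear map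
from Ad f to Ad λ is X ↦ c·tr X·1 (`IsTwisting.exists_eq_trace_smul`). Applied to a group average
this yields the twisted 1-group property (`IsTwisting.sum_entry_mul`); applied to the compression X
↦ V†X_iV of an error on one qutrit it yields the Knill-Laflamme conditions (`detectsErrors_range`).

Codes correspond to intertwining maps from λ to the tensor power. The centre fixes n mod 3, and in
the right residue class the multiplicity is `multSum n` / 1080, which vanishes for n = 1, 2, 4,
equals 1 for n = 5 and is positive from then on. Finally, the images of λ₃ and λ₄ are conjugate to
the group itself by explicit unitary matrices, so a change of logical basis makes every gate of the
group transversal. -/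

noncomputable section

/-! ### The ring `ℤ[ω, μ]` -/

/-- The ring `ℤ[μ]` with `μ² = 1 - μ`. -/
abbrev MuInt : Type := QuadraticAlgebra ℤ 1 (-1)

/-- The ring `ℤ[μ, ω]` with `μ² = 1 - μ` and `ω² = -1 - ω`. -/
abbrev CycInt : Type := QuadraticAlgebra MuInt (-1) (-1)

namespace CycInt

/-- The element `a + b μ + c ω + d μ ω`. -/
def q (a b c d : ℤ) : CycInt := ⟨⟨a, b⟩, ⟨c, d⟩⟩

lemma muPlus_sq : muPlus ^ 2 = 1 - muPlus := by
  linear_combination muPlus * muPlus_add_muMinus - muPlus_mul_muMinus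

/-- The complex embedding. -/
def toComplex : CycInt →+* ℂ where
  toFun x := x.re.re + x.re.im * muPlus + (x.im.re + x.im.im * muPlus) * zeta 3
  map_zero' := by simp
  map_one' := by simp [QuadraticAlgebra.re_one, QuadraticAlgebra.im_one]
  map_add' x y := by simp; ring
  map_mul' x y := by
    simp
    linear_combination
      (-(x.re.im + x.im.im * zeta 3) * (y.re.im + y.im.im * zeta 3) : ℂ) * muPlus_sq +
      (-(x.im.re * y.im.re + x.im.im * y.im.im + (x.im.re * y.im.im + x.im.im * y.im.re -
        x.im.im * y.im.im) * muPlus) : ℂ) * zeta3_sq_add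

lemma toComplex_apply (x : CycInt) : toComplex x =
    x.re.re + x.re.im * muPlus + (x.im.re + x.im.im * muPlus) * zeta 3 := rfl

/-- The automorphism that fixes `ω` and maps `√5` to `-√5`. -/
def sigma : CycInt →+* CycInt where
  toFun x := ⟨⟨x.re.re - x.re.im, -x.re.im⟩, ⟨x.im.re - x.im.im, -x.im.im⟩⟩
  map_zero' := by ext <;> simp
  map_one' := by ext <;> simp [QuadraticAlgebra.re_one, QuadraticAlgebra.im_one]
  map_add' x y := by ext <;> simp <;> ring
  map_mul' x y := by ext <;> simp <;> ring

/-- Complex conjugation, which fixes `√5` and maps `ω` to `ω²`. -/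
def conj : CycInt →+* CycInt where
  toFun x := ⟨⟨x.re.re - x.im.re, x.re.im - x.im.im⟩, ⟨-x.im.re, -x.im.im⟩⟩
  map_zero' := by ext <;> simp
  map_one' := by ext <;> simp [QuadraticAlgebra.re_one, QuadraticAlgebra.im_one]
  map_add' x y := by ext <;> simp <;> ring
  map_mul' x y := by ext <;> simp <;> ring

end CycInt

open CycInt

/-! ### Enumeration of the group -/

/-- The generators of `Σ(360φ)`, multiplied by two. -/
def genInt : Fin 4 → Matrix (Fin 3) (Fin 3) CycInt := ![
  !![0, 2, 0; 0, 0, 2; 2, 0, 0],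
  !![2, 0, 0; 0, -2, 0; 0, 0, -2],
  !![-1, q (-1) (-1) 0 0, q 0 1 0 0; q (-1) (-1) 0 0, q 0 1 0 0, -1; q 0 1 0 0, -1, q (-1) (-1) 0 0],
  !![-2, 0, 0; 0, 0, q 0 0 (-2) 0; 0, q 2 0 2 0, 0]]

/-- Diagonal elements of `Σ(360φ)`. -/
def diagElt (a : Fin 3) (s : Fin 4) : Fin 3 → CycInt :=
  (![1, q 0 0 1 0, q (-1) 0 (-1) 0] a : CycInt) •
    ![![1, 1, 1], ![1, -1, -1], ![-1, 1, -1], ![-1, -1, 1]] s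

/-- The matrix whose `i`-th row is `c i` times the `p i`-th row of `M`. -/
def monoAct (c : Fin 3 → CycInt) (p : Fin 3 → Fin 3) (M : Matrix (Fin 3) (Fin 3) CycInt) :
    Matrix (Fin 3) (Fin 3) CycInt :=
  Matrix.of fun i j => c i * M (p i) j

/-- Nonzero entries of representatives of the diagonal elements in the monomial elements. -/
def monoCoef : Fin 6 → Fin 3 → CycInt := ![![1, 1, 1], ![1, 1, 1], ![1, 1, 1], ![-1, q 0 0 (-1) 0, q 1 0 1 0], ![q 0 0 (-1) 0, q 1 0 1 0, -1], ![q 1 0 1 0, -1, q 0 0 (-1) 0]]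

/-- Positions of the nonzero entries of these representatives. -/
def monoPerm : Fin 6 → Fin 3 → Fin 3 := ![![0, 1, 2], ![1, 2, 0], ![2, 0, 1], ![0, 2, 1], ![2, 1, 0], ![1, 0, 2]]

/-- Representatives of the monomial elements in `Σ(360φ)`, multiplied by two. -/
def cosetRep : Fin 15 → Matrix (Fin 3) (Fin 3) CycInt := ![
  !![2, 0, 0; 0, 2, 0; 0, 0, 2],
  !![-1, q (-1) (-1) 0 0, q 0 1 0 0; q (-1) (-1) 0 0, q 0 1 0 0, -1; q 0 1 0 0, -1, q (-1) (-1) 0 0],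
  !![-1, q 1 1 0 0, q 0 (-1) 0 0; q (-1) (-1) 0 0, q 0 (-1) 0 0, 1; q 0 1 0 0, 1, q 1 1 0 0],
  !![1, q 0 1 0 1, q 0 0 1 1; q 1 1 0 0, q (-1) 0 (-1) 0, q 0 0 0 (-1); q 0 (-1) 0 0, q (-1) (-1) (-1) (-1), q 0 0 1 0],
  !![q 0 (-1) 0 0, -1, q 1 1 0 0; 1, q (-1) (-1) 0 0, q 0 (-1) 0 0; q 1 1 0 0, q 0 1 0 0, 1],
  !![1, q 0 (-1) 0 (-1), q 0 0 (-1) (-1); q 1 1 0 0, q 1 0 1 0, q 0 0 0 1; q 0 (-1) 0 0, q 1 1 1 1, q 0 0 (-1) 0],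
  !![q 1 1 0 0, q 0 (-1) 0 0, -1; q 0 (-1) 0 0, 1, q (-1) (-1) 0 0; 1, q 1 1 0 0, q 0 1 0 0],
  !![q 0 1 0 0, q 1 1 1 1, q 0 0 1 0; -1, q 0 (-1) 0 (-1), q 0 0 1 1; q (-1) (-1) 0 0, q 1 0 1 0, q 0 0 0 (-1)],
  !![q 0 0 (-1) (-1), 1, q 0 (-1) 0 (-1); q 0 0 0 1, q 1 1 0 0, q 1 0 1 0; q 0 0 (-1) 0, q 0 (-1) 0 0, q 1 1 1 1],
  !![0, q (-1) 0 0 1, q 0 1 1 1; q (-1) (-1) 0 (-1), -1, q 0 0 (-1) 0; q (-1) 0 (-1) (-1), q 1 0 1 0, -1],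
  !![q (-1) (-1) (-1) 0, 0, q 0 (-1) (-1) (-1); q 1 0 1 0, q 0 1 (-1) 0, q 0 0 (-1) 0; q 0 0 (-1) 0, q 1 1 0 1, -1],
  !![q (-1) 0 0 1, q 0 1 1 1, 0; -1, q 0 0 (-1) 0, q (-1) (-1) 0 (-1); q 1 0 1 0, -1, q (-1) 0 (-1) (-1)],
  !![q (-1) (-1) (-1) 0, 0, q 0 1 1 1; q 1 0 1 0, q 0 (-1) 1 0, q 0 0 1 0; q 0 0 (-1) 0, q (-1) (-1) 0 (-1), 1],
  !![q (-1) 0 0 1, q 0 (-1) (-1) (-1), 0; -1, q 0 0 1 0, q 1 1 0 1; q 1 0 1 0, 1, q 1 0 1 1],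
  !![0, q (-1) 0 0 1, q 0 (-1) (-1) (-1); q 1 1 0 1, -1, q 0 0 1 0; q 1 0 1 1, q 1 0 1 0, 1]]

/-- Multiplication of `cosetRep` by the generators. -/
def cosetTable : Fin 15 → Fin 4 → Fin 3 × Fin 4 × Fin 6 × Fin 15 := ![
  ![(0, 0, 1, 0), (0, 1, 0, 0), (0, 0, 0, 1), (0, 0, 3, 0)],
  ![(0, 0, 2, 1), (0, 0, 0, 2), (0, 0, 0, 0), (0, 0, 0, 3)],
  ![(0, 0, 0, 4), (0, 0, 0, 1), (0, 1, 0, 2), (0, 0, 0, 5)],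
  ![(1, 0, 1, 3), (0, 0, 0, 5), (0, 0, 3, 3), (0, 0, 0, 1)],
  ![(0, 0, 0, 6), (0, 0, 1, 6), (0, 1, 0, 6), (0, 0, 0, 7)],
  ![(0, 0, 0, 8), (0, 0, 0, 3), (0, 0, 0, 9), (0, 0, 0, 2)],
  ![(0, 0, 0, 2), (0, 0, 2, 4), (0, 1, 0, 4), (2, 0, 0, 8)],
  ![(1, 0, 0, 5), (2, 0, 1, 8), (0, 0, 0, 10), (0, 0, 0, 4)],
  ![(2, 0, 0, 7), (1, 0, 2, 7), (0, 0, 0, 11), (1, 0, 0, 6)],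
  ![(2, 0, 0, 10), (0, 0, 3, 9), (0, 0, 0, 5), (0, 1, 0, 9)],
  ![(1, 0, 0, 11), (0, 0, 0, 12), (0, 0, 0, 7), (2, 1, 0, 11)],
  ![(0, 0, 0, 9), (0, 0, 0, 13), (0, 0, 0, 8), (1, 1, 0, 10)],
  ![(1, 0, 3, 13), (0, 0, 0, 10), (2, 0, 1, 13), (2, 1, 0, 13)],
  ![(0, 0, 0, 14), (0, 0, 0, 11), (1, 0, 2, 12), (1, 1, 0, 12)],
  ![(2, 0, 3, 12), (0, 0, 3, 14), (2, 0, 5, 14), (0, 1, 3, 14)]]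

/-- Indices of the elements of `Σ(360φ)`. -/
abbrev Index : Type := Fin 3 × Fin 4 × Fin 6 × Fin 15

/-- The elements of `Σ(360φ)`, multiplied by two. -/
def code (x : Index) : Matrix (Fin 3) (Fin 3) CycInt :=
  monoAct (diagElt x.1 x.2.1 * monoCoef x.2.2.1) (monoPerm x.2.2.1) (cosetRep x.2.2.2)

lemma cosetRep_mul (i : Fin 15) (x : Fin 4) :
    cosetRep i * genInt x = (2 : CycInt) • code (cosetTable i x) := by
  revert i x
  decide +kernel

lemma exists_diagElt_mul (a a' : Fin 3) (s s' : Fin 4) :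
    ∃ a'' s'', diagElt a s * diagElt a' s' = diagElt a'' s'' := by
  revert a a' s s'
  decide +kernel

/-- The values of the character `χ₂`. -/
def chiInt : Fin 17 → CycInt := ![3, q (-3) 0 (-3) 0, q 0 0 3 0, -1, q 1 0 1 0, q 0 0 (-1) 0, 0, 0, 1, q (-1) 0 (-1) 0, q 0 0 1 0, q 0 0 0 (-1), q 0 (-1) 0 0, q 0 1 0 1, q (-1) (-1) (-1) (-1), q 0 0 1 1, q 1 1 0 0]

/-- Multiplication of the conjugacy classes by the central element `ω`. -/
def shiftClass : Fin 17 → Fin 17 := ![2, 0, 1, 5, 3, 4, 6, 7, 10, 8, 9, 13, 11, 12, 16, 14, 15]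

/-- The conjugacy classes of the elements of `Σ(360φ)`. -/
def classTable : Fin 15 → Fin 6 → Fin 4 → Fin 17 := ![
  ![![0, 3, 3, 3], ![6, 6, 6, 6], ![6, 6, 6, 6], ![3, 3, 8, 8], ![4, 9, 4, 9], ![5, 10, 10, 5]],
  ![![3, 6, 16, 12], ![3, 12, 6, 16], ![3, 16, 12, 6], ![6, 8, 10, 9], ![6, 11, 13, 12], ![6, 14, 16, 15]],
  ![![6, 3, 12, 16], ![12, 3, 16, 6], ![16, 3, 6, 12], ![8, 6, 9, 10], ![11, 6, 12, 13], ![14, 6, 15, 16]],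
  ![![6, 8, 9, 10], ![6, 16, 14, 15], ![6, 12, 13, 11], ![3, 6, 12, 16], ![5, 15, 6, 11], ![4, 13, 14, 6]],
  ![![12, 6, 3, 16], ![16, 12, 3, 6], ![6, 16, 3, 12], ![11, 13, 6, 12], ![14, 16, 6, 15], ![8, 10, 6, 9]],
  ![![8, 6, 10, 9], ![16, 6, 15, 14], ![12, 6, 11, 13], ![6, 3, 16, 12], ![15, 5, 11, 6], ![13, 4, 6, 14]],
  ![![16, 6, 12, 3], ![6, 12, 16, 3], ![12, 16, 6, 3], ![14, 15, 16, 6], ![8, 9, 10, 6], ![11, 12, 13, 6]],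
  ![![11, 13, 12, 6], ![10, 9, 8, 6], ![15, 14, 16, 6], ![12, 6, 16, 3], ![6, 15, 11, 5], ![14, 13, 6, 4]],
  ![![16, 14, 6, 15], ![12, 13, 6, 11], ![8, 9, 6, 10], ![15, 6, 5, 11], ![13, 14, 4, 6], ![6, 12, 3, 16]],
  ![![3, 8, 6, 6], ![10, 14, 8, 13], ![9, 11, 15, 8], ![8, 3, 6, 6], ![14, 10, 13, 8], ![11, 9, 8, 15]],
  ![![9, 12, 16, 10], ![8, 10, 13, 14], ![5, 6, 10, 6], ![16, 10, 9, 12], ![13, 14, 8, 10], ![10, 6, 5, 6]],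
  ![![9, 15, 8, 11], ![3, 6, 6, 8], ![10, 8, 13, 14], ![11, 8, 15, 9], ![8, 6, 6, 3], ![14, 13, 8, 10]],
  ![![12, 9, 10, 16], ![10, 8, 14, 13], ![6, 5, 6, 10], ![10, 16, 12, 9], ![14, 13, 10, 8], ![6, 10, 6, 5]],
  ![![15, 9, 11, 8], ![6, 3, 8, 6], ![8, 10, 14, 13], ![8, 11, 9, 15], ![6, 8, 3, 6], ![13, 14, 10, 8]],
  ![![6, 6, 3, 8], ![8, 13, 10, 14], ![15, 8, 9, 11], ![6, 6, 8, 3], ![13, 8, 14, 10], ![8, 15, 11, 9]]]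

/-- The conjugacy class of an element of `Σ(360φ)`. -/
def classOf (x : Index) : Fin 17 := shiftClass^[x.1] (classTable x.2.2.2 x.2.2.1 x.2.1)

/-- With this, the table of classes is needed only for the 360 indices whose central factor is 1. -/
lemma chiInt_shiftClass (k : Fin 17) : chiInt (shiftClass k) = q 0 0 1 0 * chiInt k := by
  revert k
  decide +kernel

lemma trace_code_zero (s : Fin 4) (b : Fin 6) (i : Fin 15) :
    (code (0, s, b, i)).trace = 2 * chiInt (classTable i b s) := by
  revert s b i
  decide +kernel

lemma diagElt_eq (a : Fin 3) (s : Fin 4) :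
    diagElt a s = q 0 0 1 0 ^ (a : ℕ) • diagElt 0 s := by
  revert a s
  decide +kernel

lemma trace_code (x : Index) : (code x).trace = 2 * chiInt (classOf x) := by
  obtain ⟨a, s, b, i⟩ := x
  have h1 : code (a, s, b, i) = q 0 0 1 0 ^ (a : ℕ) • code (0, s, b, i) := by
    refine Matrix.ext fun k l => ?_
    simp only [code, monoAct, diagElt_eq a s, Matrix.smul_apply, Matrix.of_apply, Pi.mul_apply,
      Pi.smul_apply, smul_eq_mul, mul_assoc]
  have h2 (n : ℕ) (k : Fin 17) : chiInt (shiftClass^[n] k) = q 0 0 1 0 ^ n * chiInt k := by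
    induction n with
    | zero => simp
    | succ n ih => rw [Function.iterate_succ_apply', chiInt_shiftClass, ih, pow_succ', mul_assoc]
  rw [h1, Matrix.trace_smul, trace_code_zero, smul_eq_mul, classOf, h2]
  exact mul_left_comm _ _ _

/-- The characters in question vanish on both classes of size 120, so these are merged into column 6
and column 7 stays empty. -/
lemma card_classOf (k : Fin 17) : (Finset.univ.filter fun x : Index => classOf x = k).card =
    (![1, 1, 1, 45, 45, 45, 240, 0, 90, 90, 90, 72, 72, 72, 72, 72, 72] : Fin 17 → ℕ) k := by
  revert k
  decide +kernel

/-- A linear functional modulo a prime which separates the elements of `Σ(360φ)`. -/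
def key (M : Matrix (Fin 3) (Fin 3) CycInt) : ℕ :=
  let f (z : CycInt) : ℤ := z.re.re + 111 * z.re.im - 226 * z.im.re - 26 * z.im.im
  ((146 * f (M 0 0) - 103 * f (M 0 1) - 25 * f (M 0 2) - 38 * f (M 1 0) - 140 * f (M 1 1) -
    26 * f (M 1 2)) % 65521).toNat

/-- Tests whether the members of a list are distinct and none of them is a bit of `m`. -/
def distinctBits : List ℕ → ℕ → Bool
  | [], _ => true
  | k :: l, m => !m.testBit k && distinctBits l (m ||| 1 <<< k)

lemma distinctBits_spec {l : List ℕ} {m : ℕ} (h : distinctBits l m = true) :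
    l.Nodup ∧ ∀ k ∈ l, m.testBit k = false := by
  induction l generalizing m with
  | nil => simp
  | cons k l ih =>
    simp only [distinctBits, Bool.and_eq_true, Bool.not_eq_true'] at h
    obtain ⟨h1, h2⟩ := ih h.2
    have h3 : ∀ j ∈ l, k ≠ j ∧ m.testBit j = false := by
      intro j hj
      have := h2 j hj
      simp only [Nat.testBit_or, Bool.or_eq_false_iff, Nat.one_shiftLeft,
        Nat.testBit_two_pow, decide_eq_false_iff_not] at this
      exact ⟨this.2, this.1⟩
    refine ⟨List.nodup_cons.2 ⟨fun hk => (h3 k hk).1 rfl, h1⟩, ?_⟩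
    rintro j hj
    rcases List.mem_cons.1 hj with rfl | hj
    · exact h.1
    · exact (h3 j hj).2

/-- The list of all indices. -/
def indexList : List Index :=
  List.finRange 3 ×ˢ (List.finRange 4 ×ˢ (List.finRange 6 ×ˢ List.finRange 15))

/-- A single pass with a bit mask over 1080 small numbers replaces the pairwise comparison of 1080
matrices. -/
lemma distinctBits_key : distinctBits (indexList.map fun x => key (code x)) 0 = true := by
  decide +kernel

lemma code_injective : Function.Injective code := by
  intro x y h
  refine List.inj_on_of_nodup_map (distinctBits_spec distinctBits_key).1 ?_ ?_
    (congrArg key h) <;>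
  exact List.mem_product.2 ⟨List.mem_finRange _, List.mem_product.2 ⟨List.mem_finRange _,
    List.mem_product.2 ⟨List.mem_finRange _, List.mem_finRange _⟩⟩⟩

/-! ### The embedding into the complex numbers, and halving of matrices -/

namespace CycInt

lemma star_toComplex (x : CycInt) : star (toComplex x) = toComplex (conj x) := by
  have h1 : (starRingEnd ℂ) muPlus = muPlus := star_muPlus
  have h2 : (starRingEnd ℂ) (zeta 3) = zeta 3 ^ 2 := star_zeta3
  simp only [toComplex_apply, conj, RingHom.coe_mk, MonoidHom.coe_mk, OneHom.coe_mk,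
    Complex.star_def, map_add, map_mul, h1, h2, map_intCast]
  push_cast
  linear_combination (x.im.re + x.im.im * muPlus : ℂ) * zeta3_sq_add

lemma im_zeta3_ne_zero : (zeta 3).im ≠ 0 := by
  intro h
  have h1 := congrArg Complex.re zeta3_sq_add
  simp [pow_two, h] at h1
  nlinarith [sq_nonneg ((zeta 3).re + 1 / 2)]

lemma int_add_mul_mu {a b : ℤ} (h : (a + b * ((-1 + √5) / 2) : ℝ) = 0) : a = 0 ∧ b = 0 := by
  have hb : b = 0 := by
    by_contra hb
    have hirr : Irrational √5 := by
      simpa using (show Nat.Prime 5 by norm_num).irrational_sqrt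
    apply hirr
    refine ⟨((b - 2 * a : ℤ) : ℚ) / (b : ℚ), ?_⟩
    have hb' : (b : ℝ) ≠ 0 := by exact_mod_cast hb
    push_cast
    field_simp
    linarith
  subst hb
  simp at h
  exact ⟨h, rfl⟩

/-- As ω is not real, the imaginary part isolates the coefficient of ω; irrationality of √5 then
separates 1 from μ. -/
lemma toComplex_injective : Function.Injective toComplex := by
  rw [injective_iff_map_eq_zero]
  intro x hx
  have hx' : (((x.re.re + x.re.im * ((-1 + √5) / 2) : ℝ) : ℂ) +
      ((x.im.re + x.im.im * ((-1 + √5) / 2) : ℝ) : ℂ) * zeta 3) = 0 := by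
    rw [← hx, toComplex_apply, muPlus]
    push_cast
    ring
  have h1 := congrArg Complex.im hx'
  rw [Complex.add_im, Complex.ofReal_im, Complex.im_ofReal_mul, zero_add, Complex.zero_im] at h1
  have h2 := (mul_eq_zero.1 h1).resolve_right im_zeta3_ne_zero
  rw [h2] at hx'
  simp only [Complex.ofReal_zero, zero_mul, add_zero] at hx'
  have h3 := int_add_mul_mu h2
  have h4 := int_add_mul_mu (Complex.ofReal_eq_zero.1 hx')
  ext <;> simp [h3, h4]

/-- The complex embedding of matrices. -/
abbrev matC : Matrix (Fin 3) (Fin 3) CycInt →+* Matrix (Fin 3) (Fin 3) ℂ :=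
  toComplex.mapMatrix

lemma toComplex_two : toComplex 2 = 2 := map_ofNat _ 2

lemma matC_injective : Function.Injective matC :=
  Matrix.map_injective toComplex_injective

lemma matC_two_smul (N : Matrix (Fin 3) (Fin 3) CycInt) :
    matC ((2 : CycInt) • N) = (2 : ℂ) • matC N := by
  ext i j
  simp [toComplex_two]

lemma star_matC (N : Matrix (Fin 3) (Fin 3) CycInt) :
    star (matC N) = matC (conj.mapMatrix N)ᵀ := by
  ext i j
  simp [Matrix.star_apply, ← star_toComplex]

lemma sigma_conj (z : CycInt) : sigma (conj z) = conj (sigma z) := by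
  ext <;> simp [sigma, conj] <;> ring

end CycInt

/-- The generators of `Σ(360φ)`. -/
def genU : Fin 4 → unitaryGroup (Fin 3) ℂ :=
  ![⟨genA, genA_mem⟩, ⟨genE, genE_mem⟩, ⟨genW, genW_mem⟩, ⟨genZ, genZ_mem⟩]

lemma sigma360_eq_closure : sigma360 = Subgroup.closure (Set.range genU) := by
  rw [sigma360]
  congr 1
  ext U
  simp [genU]
  tauto

/-- The matrix `N`, divided by two, is the matrix `U`. -/
def IsDouble (U : Matrix (Fin 3) (Fin 3) ℂ) (N : Matrix (Fin 3) (Fin 3) CycInt) : Prop :=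
  (2 : ℂ) • U = matC N

lemma toComplex_q (a b c d : ℤ) :
    toComplex (q a b c d) = a + b * muPlus + (c + d * muPlus) * zeta 3 := rfl

lemma isDouble_genU (x : Fin 4) : IsDouble (genU x).1 (genInt x) := by
  have h1 : muMinus = -1 - muPlus := by linear_combination muPlus_add_muMinus
  have h2 := zeta3_sq_add
  rw [IsDouble]
  ext i j
  fin_cases x <;> fin_cases i <;> fin_cases j <;>
    simp [genU, genInt, genA, genE, genW, genZ, toComplex_q, toComplex_two, h1] <;>
    first
      | ring1
      | linear_combination (-2) * h2

namespace IsDouble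

variable {U V : Matrix (Fin 3) (Fin 3) ℂ} {M N P : Matrix (Fin 3) (Fin 3) CycInt}

/-- Products of doubled matrices carry a factor 4. Stating the product as twice some `P` avoids
division in ℤ[μ, ω]. -/
lemma mul (hU : IsDouble U M) (hV : IsDouble V N) (h : M * N = (2 : CycInt) • P) :
    IsDouble (U * V) P := by
  rw [IsDouble] at *
  have h1 : (2 : ℂ) • (2 : ℂ) • (U * V) = (2 : ℂ) • matC P := by
    rw [← matC_two_smul, ← h, map_mul, ← hU, ← hV, smul_mul_smul, smul_smul]
  exact smul_right_injective _ (two_ne_zero' ℂ) h1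

lemma mul_eq (hU : IsDouble U M) (hV : IsDouble V N) (h : IsDouble (U * V) P) :
    M * N = (2 : CycInt) • P := by
  apply matC_injective
  rw [IsDouble] at *
  rw [matC_two_smul, ← h, map_mul, ← hU, ← hV, smul_mul_smul, smul_smul]

lemma left_unique (hU : IsDouble U M) (hV : IsDouble V M) : U = V :=
  smul_right_injective _ (two_ne_zero' ℂ) (Eq.trans hU (Eq.symm hV))

lemma right_unique (hU : IsDouble U M) (hV : IsDouble U N) : M = N :=
  matC_injective (Eq.trans (Eq.symm hU) hV)

lemma one : IsDouble 1 2 := by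
  rw [IsDouble, map_ofNat, two_smul, one_add_one_eq_two]

end IsDouble

/-! ### Closure under multiplication -/

lemma monoAct_mul (c : Fin 3 → CycInt) (p : Fin 3 → Fin 3)
    (M N : Matrix (Fin 3) (Fin 3) CycInt) : monoAct c p M * N = monoAct c p (M * N) := by
  refine Matrix.ext fun i j => ?_
  simp [monoAct, Matrix.mul_apply, Finset.mul_sum, mul_assoc]

lemma monoAct_monoAct (c c' : Fin 3 → CycInt) (p p' : Fin 3 → Fin 3)
    (M : Matrix (Fin 3) (Fin 3) CycInt) :
    monoAct c p (monoAct c' p' M) = monoAct (c * c' ∘ p) (p' ∘ p) M := by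
  refine Matrix.ext fun i j => ?_
  simp [monoAct, mul_assoc]

lemma monoAct_smul (a : CycInt) (c : Fin 3 → CycInt) (p : Fin 3 → Fin 3)
    (M : Matrix (Fin 3) (Fin 3) CycInt) : monoAct c p (a • M) = a • monoAct c p M := by
  refine Matrix.ext fun i j => ?_
  simp [monoAct, mul_left_comm]

lemma exists_diagElt_comp (a : Fin 3) (s : Fin 4) (b : Fin 6) :
    ∃ s', diagElt a s ∘ monoPerm b = diagElt a s' := by
  revert a s b
  decide +kernel

lemma exists_monoCoef_mul (b b' : Fin 6) :
    ∃ b'', monoPerm b' ∘ monoPerm b = monoPerm b'' ∧ ∃ a s,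
      monoCoef b * monoCoef b' ∘ monoPerm b = diagElt a s * monoCoef b'' := by
  revert b b'
  decide +kernel

/-- The generator moves the coset representative to another one, with a monomial factor on the left.
Its diagonal part is carried past the permutation of `x`, which only permutes the signs, and the two
monomial factors combine within the list. -/
lemma exists_code_mul_genInt (x : Index) (y : Fin 4) :
    ∃ z, code x * genInt y = (2 : CycInt) • code z := by
  obtain ⟨a, s, b, i⟩ := x
  obtain ⟨⟨a₁, s₁, b₁, i₁⟩, h⟩ : ∃ z, cosetTable i y = z := ⟨_, rfl⟩
  obtain ⟨s₂, h₂⟩ := exists_diagElt_comp a₁ s₁ b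
  obtain ⟨b₃, h₃, a₃, s₃, h₃'⟩ := exists_monoCoef_mul b b₁
  obtain ⟨a₄, s₄, h₄⟩ := exists_diagElt_mul a a₁ s s₂
  obtain ⟨a₅, s₅, h₅⟩ := exists_diagElt_mul a₄ a₃ s₄ s₃
  refine ⟨(a₅, s₅, b₃, i₁), ?_⟩
  simp only [code]
  rw [monoAct_mul, cosetRep_mul, monoAct_smul, code, h, monoAct_monoAct, h₃, ← h₅, ← h₄]
  congr 2
  have : (diagElt a₁ s₁ * monoCoef b₁) ∘ monoPerm b =
      diagElt a₁ s₂ * monoCoef b₁ ∘ monoPerm b := by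
    rw [← h₂]
    rfl
  rw [this, mul_assoc _ _ (monoCoef b₃), ← h₃']
  ring

lemma code_zero : code (0, 0, 0, 0) = 2 := by decide +kernel

lemma genU_mem (x : Fin 4) : genU x ∈ sigma360 := by
  rw [sigma360_eq_closure]
  exact Subgroup.subset_closure ⟨x, rfl⟩

/-- The generators have order 3 or 2, so closure under right multiplication by generators covers
their inverses too. -/
lemma genU_inv (x : Fin 4) : (genU x)⁻¹ = genU x * genU x ∨ (genU x)⁻¹ = genU x := by
  have h : genInt x * genInt x = (2 : CycInt) • 2 ∨
      genInt x * genInt x = (2 : CycInt) • code (0, 0, 2, 0) ∧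
        genInt x * code (0, 0, 2, 0) = (2 : CycInt) • 2 := by
    revert x
    decide +kernel
  have hx := isDouble_genU x
  simp only [inv_eq_iff_mul_eq_one]
  rcases h with h | ⟨h, h'⟩
  · exact Or.inr (Subtype.ext ((hx.mul hx h).left_unique .one))
  · exact Or.inl (Subtype.ext ((hx.mul (hx.mul hx h) h').left_unique .one))

lemma exists_code {U : unitaryGroup (Fin 3) ℂ} (hU : U ∈ sigma360) :
    ∃ x, IsDouble U.1 (code x) := by
  have key (U : unitaryGroup (Fin 3) ℂ) (y : Fin 4) (h : ∃ x, IsDouble U.1 (code x)) :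
      ∃ x, IsDouble (U * genU y).1 (code x) := by
    obtain ⟨x, hx⟩ := h
    obtain ⟨z, hz⟩ := exists_code_mul_genInt x y
    exact ⟨z, hx.mul (isDouble_genU y) hz⟩
  rw [sigma360_eq_closure] at hU
  induction hU using Subgroup.closure_induction_right with
  | one => exact ⟨(0, 0, 0, 0), code_zero.symm ▸ IsDouble.one⟩
  | mul_right U _ y hy h =>
    obtain ⟨y, rfl⟩ := hy
    exact key U y h
  | mul_inv_cancel U _ y hy h =>
    obtain ⟨y, rfl⟩ := hy
    rcases genU_inv y with hy | hy <;> rw [hy]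
    · rw [← mul_assoc]
      exact key _ y (key U y h)
    · exact key U y h

/-- The matrix `N`, divided by two, is an element of `Σ(360φ)`. -/
def IsDoubleMem (N : Matrix (Fin 3) (Fin 3) CycInt) : Prop :=
  ∃ U ∈ sigma360, IsDouble U.1 N

lemma IsDoubleMem.mul {M N P : Matrix (Fin 3) (Fin 3) CycInt} (hM : IsDoubleMem M)
    (hN : IsDoubleMem N) (h : M * N = (2 : CycInt) • P) : IsDoubleMem P := by
  obtain ⟨U, hU, hU'⟩ := hM
  obtain ⟨V, hV, hV'⟩ := hN
  exact ⟨U * V, mul_mem hU hV, hU'.mul hV' h⟩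

lemma isDoubleMem_genInt (x : Fin 4) : IsDoubleMem (genInt x) :=
  ⟨_, genU_mem x, isDouble_genU x⟩

lemma code_eq_cosetRep (i : Fin 15) : code (0, 0, 0, i) = cosetRep i := by
  refine Matrix.ext fun k l => ?_
  have h : ∀ k, diagElt 0 0 k * monoCoef 0 k = 1 ∧ monoPerm 0 k = k := by decide +kernel
  simp only [code, monoAct, Matrix.of_apply, Pi.mul_apply, h, one_mul]

lemma isDoubleMem_cosetRep (i : Fin 15) : IsDoubleMem (cosetRep i) := by
  -- The representatives form a tree rooted at the identity: each later one is exactly an earlier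
  -- one times a generator, with trivial monomial factor.
  have h : ∀ i : Fin 15, i ≠ 0 → ∃ j < i, ∃ x, cosetTable j x = (0, 0, 0, i) := by
    decide +kernel
  induction i using WellFoundedLT.induction with
  | _ i ih =>
    by_cases hi : i = 0
    · rw [hi, ← code_eq_cosetRep, code_zero]
      exact ⟨1, one_mem _, .one⟩
    · obtain ⟨j, hj, x, hx⟩ := h i hi
      refine (ih j hj).mul (isDoubleMem_genInt x) ?_
      rw [cosetRep_mul, hx, code_eq_cosetRep]

lemma isDoubleMem_code (x : Index) : IsDoubleMem (code x) := by
  have h1 : IsDoubleMem (code (0, 0, 1, 0)) := by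
    rw [show code (0, 0, 1, 0) = genInt 0 by decide +kernel]
    exact isDoubleMem_genInt 0
  have h3 : IsDoubleMem (code (0, 0, 3, 0)) := by
    rw [show code (0, 0, 3, 0) = genInt 3 by decide +kernel]
    exact isDoubleMem_genInt 3
  have hE : IsDoubleMem (code (0, 1, 0, 0)) := by
    rw [show code (0, 1, 0, 0) = genInt 1 by decide +kernel]
    exact isDoubleMem_genInt 1
  have h0 : IsDoubleMem (code (0, 0, 0, 0)) := code_zero ▸ ⟨1, one_mem _, .one⟩
  have h2 : IsDoubleMem (code (0, 0, 2, 0)) := h1.mul h1 (by decide +kernel)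
  have h4 : IsDoubleMem (code (0, 0, 4, 0)) := h1.mul h3 (by decide +kernel)
  have h5 : IsDoubleMem (code (0, 0, 5, 0)) := h2.mul h3 (by decide +kernel)
  have hb (b : Fin 6) : IsDoubleMem (code (0, 0, b, 0)) := by
    fin_cases b
    exacts [h0, h1, h2, h3, h4, h5]
  have hE2 : IsDoubleMem (code (0, 2, 0, 0)) :=
    (h2.mul hE (P := code (0, 2, 2, 0)) (by decide +kernel)).mul h1 (by decide +kernel)
  have hE3 : IsDoubleMem (code (0, 3, 0, 0)) :=
    (h1.mul hE (P := code (0, 3, 1, 0)) (by decide +kernel)).mul h2 (by decide +kernel)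
  have hs (s : Fin 4) : IsDoubleMem (code (0, s, 0, 0)) := by
    fin_cases s
    exacts [h0, hE, hE2, hE3]
  -- The scalar ω is the square of `genA * genZ`.
  have hw : IsDoubleMem (code (1, 0, 0, 0)) := h4.mul h4 (by decide +kernel)
  have hw2 : IsDoubleMem (code (2, 0, 0, 0)) := hw.mul hw (by decide +kernel)
  have ha (a : Fin 3) : IsDoubleMem (code (a, 0, 0, 0)) := by
    fin_cases a
    exacts [h0, hw, hw2]
  obtain ⟨a, s, b, i⟩ := x
  have hd : ∀ a s, diagElt a 0 * diagElt 0 s = diagElt a s := by decide +kernel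
  have hd0 : diagElt 0 0 = 1 := by decide +kernel
  have hc0 : monoCoef 0 = 1 := by decide +kernel
  have hp0 : monoPerm 0 = id := by decide +kernel
  have ht0 : cosetRep 0 = (2 : CycInt) • 1 := by decide +kernel
  have h6 : IsDoubleMem (code (a, s, 0, 0)) := by
    refine (ha a).mul (hs s) ?_
    simp only [code, monoAct_mul, ht0, hc0, hp0, smul_mul_assoc, one_mul, monoAct_smul,
      monoAct_monoAct, mul_one, Function.comp_id, hd]
  have h7 : IsDoubleMem (code (a, s, b, 0)) := by
    refine h6.mul (hb b) ?_
    simp only [code, monoAct_mul, ht0, hc0, hp0, hd0, smul_mul_assoc, one_mul, monoAct_smul,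
      monoAct_monoAct, mul_one, Function.comp_id]
  refine h7.mul (isDoubleMem_cosetRep i) ?_
  simp only [code, monoAct_mul, ht0, smul_mul_assoc, one_mul, monoAct_smul]

/-- The element of `Σ(360φ)` with a given index. -/
def elt (x : Index) : sigma360 := ⟨(isDoubleMem_code x).choose, (isDoubleMem_code x).choose_spec.1⟩

lemma isDouble_elt (x : Index) : IsDouble (elt x).1.1 (code x) :=
  (isDoubleMem_code x).choose_spec.2

lemma elt_bijective : Function.Bijective elt := by
  constructor
  · intro x y h
    have hx := isDouble_elt x
    rw [h] at hx
    exact code_injective (hx.right_unique (isDouble_elt y))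
  · intro g
    obtain ⟨x, hx⟩ := exists_code g.2
    exact ⟨x, Subtype.ext (Subtype.ext ((isDouble_elt x).left_unique hx))⟩

/-- The enumeration of `Σ(360φ)`. -/
def eltEquiv : Index ≃ sigma360 := Equiv.ofBijective elt elt_bijective

instance finite_sigma360 : Finite sigma360 := Finite.of_equiv _ eltEquiv

instance fintype_sigma360 : Fintype sigma360 := Fintype.ofEquiv _ eltEquiv

/-! ### Order, determinants and perfectness -/

lemma card_sigma360 : Nat.card sigma360 = 1080 := by
  rw [← Nat.card_congr eltEquiv]
  simp

lemma det_eq_one {U : unitaryGroup (Fin 3) ℂ} (hU : U ∈ sigma360) : U.1.det = 1 := by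
  have h (x : Fin 4) : (genU x).1.det = 1 := by
    -- Doubling a 3 × 3 matrix multiplies its determinant by 2³.
    have h1 : (genInt x).det = 8 := by
      revert x
      simp only [Matrix.det_fin_three]
      decide +kernel
    have h2 := congrArg toComplex h1
    rw [RingHom.map_det, ← isDouble_genU, Matrix.det_smul] at h2
    simp only [Fintype.card_fin, map_ofNat] at h2
    linear_combination h2 / 8
  rw [sigma360_eq_closure] at hU
  induction hU using Subgroup.closure_induction with
  | mem U hU =>
    obtain ⟨x, rfl⟩ := hU
    exact h x
  | one => simp
  | mul U V _ _ hU hV => simp [hU, hV]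
  | inv U _ hU =>
    have h1 : U.1.det * (U⁻¹).1.det = 1 := by
      rw [← Matrix.det_mul]
      simp
    rwa [hU, one_mul] at h1

/-- The generators as elements of `Σ(360φ)`. -/
def gen (x : Fin 4) : sigma360 := ⟨genU x, genU_mem x⟩

lemma closure_gen : Subgroup.closure (Set.range gen) = ⊤ := by
  rw [eq_top_iff]
  rintro ⟨U, hU⟩ -
  have h : Subgroup.closure (Set.range genU) ≤
      (Subgroup.closure (Set.range gen)).map sigma360.subtype := by
    rw [Subgroup.closure_le]
    rintro _ ⟨x, rfl⟩
    exact ⟨gen x, Subgroup.subset_closure ⟨x, rfl⟩, rfl⟩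
  rw [sigma360_eq_closure] at hU
  obtain ⟨V, hV, hVU⟩ := h hU
  rwa [show (⟨U, _⟩ : sigma360) = V from Subtype.ext hVU.symm]

/-- Each generator is a single commutator: g y z = z y says g = [z, y]. The pairs in the proof are
explicit witnesses. -/
lemma exists_mul_code_mul_code (x : Fin 4) :
    ∃ y z : Index, genInt x * (code y * code z) = (2 : CycInt) • (code z * code y) := by
  have h : ∀ x, genInt x *
      (code (![(0, 0, 2, 1), (1, 3, 1, 0), (0, 2, 2, 6), (1, 3, 3, 14)] x) *
        code (![(0, 0, 2, 0), (0, 0, 1, 0), (1, 2, 1, 0), (0, 1, 0, 0)] x)) = (2 : CycInt) •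
      (code (![(0, 0, 2, 0), (0, 0, 1, 0), (1, 2, 1, 0), (0, 1, 0, 0)] x) *
        code (![(0, 0, 2, 1), (1, 3, 1, 0), (0, 2, 2, 6), (1, 3, 3, 14)] x)) := by
    decide +kernel
  exact ⟨_, _, h x⟩

open scoped commutatorElement in
lemma commutator_sigma360 : commutator sigma360 = ⊤ := by
  rw [eq_top_iff, ← closure_gen, Subgroup.closure_le]
  rintro _ ⟨x, rfl⟩
  obtain ⟨y, z, h⟩ := exists_mul_code_mul_code x
  have h1 : gen x * (elt y * elt z) = elt z * elt y := by
    apply Subtype.ext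
    apply Subtype.ext
    change (genU x).1 * ((elt y).1.1 * (elt z).1.1) = (elt z).1.1 * (elt y).1.1
    have h2 := congrArg matC h
    rw [matC_two_smul, map_mul, map_mul, map_mul, ← isDouble_genU, ← isDouble_elt,
      ← isDouble_elt] at h2
    simp only [smul_mul_smul, smul_smul] at h2
    refine smul_right_injective _ (show (2 * (2 * 2) : ℂ) ≠ 0 by norm_num) ?_
    exact h2
  have h2 : gen x = ⁅elt z, elt y⁆ := by
    rw [commutatorElement_def, ← h1]
    group
  rw [SetLike.mem_coe, h2, commutator_def]
  exact Subgroup.commutator_mem_commutator (Subgroup.mem_top _) (Subgroup.mem_top _)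

/-! ### Galois conjugates of the fundamental representation -/

/-- The index of an element of `Σ(360φ)`. -/
def idx (g : sigma360) : Index := eltEquiv.symm g

lemma isDouble_idx (g : sigma360) : IsDouble g.1.1 (code (idx g)) := by
  have := isDouble_elt (idx g)
  rwa [show elt (idx g) = g from eltEquiv.apply_symm_apply g] at this

lemma code_mul_star (g : sigma360) :
    code (idx g) * (conj.mapMatrix (code (idx g)))ᵀ = (2 : CycInt) • 2 := by
  apply matC_injective
  have h : g.1.1 * star g.1.1 = 1 := Unitary.coe_mul_star_self g.1
  rw [map_mul, ← star_matC, ← isDouble_idx, star_smul, smul_mul_smul, h, matC_two_smul,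
    map_ofNat, ← one_add_one_eq_two (R := Matrix (Fin 3) (Fin 3) ℂ), ← two_smul ℂ, smul_smul]
  simp

/-- The Galois conjugate of the fundamental representation under a ring endomorphism which
commutes with complex conjugation. -/
def galoisRep (τ : CycInt →+* CycInt) (hτ : ∀ z, τ (conj z) = conj (τ z)) :
    sigma360 →* unitaryGroup (Fin 3) ℂ where
  -- Unitarity and multiplicativity are equations over ℤ[μ, ω] in the doubled matrices and the
  -- integer 2, so `τ` preserves them; for unitarity it must commute with conjugation.
  toFun g := ⟨(2⁻¹ : ℂ) • matC (τ.mapMatrix (code (idx g))), by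
    have h := congrArg (fun N => matC (τ.mapMatrix N)) (code_mul_star g)
    have h1 : τ.mapMatrix (conj.mapMatrix (code (idx g)))ᵀ =
        (conj.mapMatrix (τ.mapMatrix (code (idx g))))ᵀ := by
      ext i j : 1
      simp [hτ]
    have h2 : τ.mapMatrix ((2 : CycInt) • (2 : Matrix (Fin 3) (Fin 3) CycInt)) =
        (2 : CycInt) • 2 := by
      rw [show ((2 : CycInt) • (2 : Matrix (Fin 3) (Fin 3) CycInt)) = 4 by decide +kernel,
        map_ofNat]
    simp only [map_mul] at h
    rw [h1, h2, ← star_matC, matC_two_smul, map_ofNat] at h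
    rw [mem_unitaryGroup_iff, star_smul, smul_mul_smul, h,
      ← one_add_one_eq_two (R := Matrix (Fin 3) (Fin 3) ℂ), ← two_smul ℂ, smul_smul, smul_smul]
    simp⟩
  map_one' := by
    apply Subtype.ext
    have h : code (idx 1) = 2 := (isDouble_idx 1).right_unique .one
    simp only [h, map_ofNat]
    rw [← one_add_one_eq_two (R := Matrix (Fin 3) (Fin 3) ℂ), ← two_smul ℂ, smul_smul]
    simp
  map_mul' g h := by
    apply Subtype.ext
    have h1 := (isDouble_idx g).mul_eq (isDouble_idx h) (isDouble_idx (g * h))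
    have h2 := congrArg (fun N => matC (τ.mapMatrix N)) h1
    have h3 (N : Matrix (Fin 3) (Fin 3) CycInt) :
        τ.mapMatrix ((2 : CycInt) • N) = (2 : CycInt) • τ.mapMatrix N := by
      ext i j : 1
      simp [map_ofNat τ 2]
    simp only [map_mul, h3, matC_two_smul] at h2
    change (2⁻¹ : ℂ) • matC (τ.mapMatrix (code (idx (g * h)))) =
      (2⁻¹ : ℂ) • matC (τ.mapMatrix (code (idx g))) *
      (2⁻¹ : ℂ) • matC (τ.mapMatrix (code (idx h)))
    rw [smul_mul_smul, h2, smul_smul]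
    norm_num

variable {τ : CycInt →+* CycInt} {hτ : ∀ z, τ (conj z) = conj (τ z)}

lemma isDouble_galoisRep (g : sigma360) :
    IsDouble (galoisRep τ hτ g).1 (τ.mapMatrix (code (idx g))) := by
  change (2 : ℂ) • (2⁻¹ : ℂ) • matC (τ.mapMatrix (code (idx g))) = _
  rw [smul_smul]
  norm_num

lemma isDouble_galoisRep_of_isDouble {g : sigma360} {N : Matrix (Fin 3) (Fin 3) CycInt}
    (h : IsDouble g.1.1 N) : IsDouble (galoisRep τ hτ g).1 (τ.mapMatrix N) := by
  rw [h.right_unique (isDouble_idx g)]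
  exact isDouble_galoisRep g

lemma unitaryChar_galoisRep (g : sigma360) :
    unitaryChar (galoisRep τ hτ) g = toComplex (τ (chiInt (classOf (idx g)))) := by
  have h1 := congrArg Matrix.trace (isDouble_galoisRep (τ := τ) (hτ := hτ) g)
  have h2 := congrArg (fun z => toComplex (τ z)) (trace_code (idx g))
  have h3 : toComplex (τ (code (idx g)).trace) =
      (matC (τ.mapMatrix (code (idx g)))).trace := by
    simp [Matrix.trace, Fin.sum_univ_three]
  rw [← h3, h2, map_mul, map_ofNat, map_mul, map_ofNat, Matrix.trace_smul, smul_eq_mul] at h1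
  exact mul_left_cancel₀ two_ne_zero h1

lemma galoisRep_id : galoisRep (RingHom.id _) (fun _ => rfl) = fundamentalRep := by
  ext1 g
  apply Subtype.ext
  exact (isDouble_galoisRep g).left_unique (isDouble_idx g)

/-- The representation with character `χ₃`. -/
def lam3 : sigma360 →* unitaryGroup (Fin 3) ℂ := galoisRep sigma sigma_conj

/-- The representation with character `χ₄`. -/
def lam4 : sigma360 →* unitaryGroup (Fin 3) ℂ :=
  galoisRep (sigma.comp conj) fun z => sigma_conj (conj z)

/-! ### The characters -/

lemma zeta_pow_self {k : ℕ} (hk : k ≠ 0) : zeta k ^ k = 1 :=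
  (Complex.isPrimitiveRoot_exp k hk).pow_eq_one

lemma zeta3_eq : zeta 3 = zeta 15 ^ 5 := by
  rw [zeta, zeta, ← Complex.exp_nat_mul]
  congr 1
  push_cast
  ring

lemma zeta5_eq : zeta 5 = zeta 15 ^ 3 := by
  rw [zeta, zeta, ← Complex.exp_nat_mul]
  congr 1
  push_cast
  ring

/-- Both sides are 2 cos(2π/5), computed by the double angle formula from cos(π/5) = (1 + √5)/4. -/
lemma muPlus_eq_zeta5 : muPlus = zeta 5 + zeta 5 ^ 4 := by
  have h1 : zeta 5 = Complex.exp ((2 * (Real.pi / 5) : ℝ) * Complex.I) := by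
    rw [zeta]
    congr 1
    push_cast
    ring
  have h2 : zeta 5 ^ 4 = Complex.exp (-(2 * (Real.pi / 5) : ℝ) * Complex.I) := by
    have h3 : zeta 5 ^ 4 * zeta 5 = 1 := by
      rw [← pow_succ]
      exact zeta_pow_self (by norm_num)
    rw [neg_mul, Complex.exp_neg, ← h1]
    exact eq_inv_of_mul_eq_one_left h3
  rw [h2, h1, ← Complex.two_cos, ← Complex.ofReal_cos, Real.cos_two_mul, Real.cos_pi_div_five,
    muPlus]
  have h : (√5 : ℝ) ^ 2 = 5 := Real.sq_sqrt (by norm_num)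
  have h5 : (-1 + √5) / 2 = 2 * (2 * ((1 + √5) / 4) ^ 2 - 1) := by linear_combination (-1 / 4) * h
  rw [h5]
  push_cast
  ring

lemma muPlus_eq : muPlus = zeta 15 ^ 3 + zeta 15 ^ 12 := by
  rw [muPlus_eq_zeta5, zeta5_eq]
  ring

lemma geom_sum_zeta15 : 1 + zeta 15 ^ 3 + zeta 15 ^ 6 + zeta 15 ^ 9 + zeta 15 ^ 12 = 0 := by
  have h := (Complex.isPrimitiveRoot_exp 5 (by norm_num)).geom_sum_eq_zero (by norm_num)
  simp only [Finset.sum_range_succ, Finset.sum_range_zero] at h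
  change 0 + zeta 5 ^ 0 + zeta 5 ^ 1 + zeta 5 ^ 2 + zeta 5 ^ 3 + zeta 5 ^ 4 = 0 at h
  rw [zeta5_eq] at h
  linear_combination h

lemma sum_zeta15 : zeta 15 ^ 10 + zeta 15 ^ 5 + 1 = 0 := by
  have h := zeta3_sq_add
  rw [zeta3_eq] at h
  linear_combination h

/-- Everything is written in ζ₁₅; the comparison then uses ζ₁₅¹⁵ = 1 and the vanishing sums of the
cube roots and of the fifth roots of unity. -/
lemma toComplex_chiInt (k : Fin 17) : toComplex (chiInt k) = chi2 k := by
  have h1 := zeta_pow_self (show 15 ≠ 0 by norm_num)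
  have h2 := sum_zeta15
  have h3 := geom_sum_zeta15
  fin_cases k <;>
    simp [chiInt, chi2, map_ofNat toComplex 3, toComplex_q, zeta3_eq, zeta5_eq, muPlus_eq] <;>
    grind

lemma toComplex_sigma_chiInt (k : Fin 17) : toComplex (sigma (chiInt k)) = chi3 k := by
  have h1 := zeta_pow_self (show 15 ≠ 0 by norm_num)
  have h2 := sum_zeta15
  have h3 := geom_sum_zeta15
  have h4 (a b c d : ℤ) : sigma (q a b c d) = q (a - b) (-b) (c - d) (-d) := rfl
  fin_cases k <;>
    simp [chiInt, chi3, map_ofNat toComplex 3, map_ofNat sigma 3, toComplex_q, h4, zeta3_eq,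
      zeta5_eq, muPlus_eq] <;>
    grind

lemma star_chi3 (k : Fin 17) : star (chi3 k) = chi4 k := by
  have h1 := zeta_pow_self (show 15 ≠ 0 by norm_num)
  have h3 : (starRingEnd ℂ) (zeta 15) = zeta 15 ^ 14 := by
    have h : ‖zeta 15‖ = 1 := by
      have h2 : ‖zeta 15‖ ^ 15 = 1 := by rw [← norm_pow, h1, norm_one]
      exact (pow_eq_one_iff_of_nonneg (norm_nonneg _) (by norm_num)).mp h2
    have h2 := Complex.mul_conj' (zeta 15)
    rw [h] at h2
    simp only [Complex.ofReal_one, one_pow] at h2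
    linear_combination (-starRingEnd ℂ (zeta 15)) * h1 + zeta 15 ^ 14 * h2
  fin_cases k <;> simp [chi3, chi4, zeta3_eq, zeta5_eq, h3] <;> grind

lemma toComplex_sigma_conj_chiInt (k : Fin 17) :
    toComplex (sigma (conj (chiInt k))) = chi4 k := by
  rw [sigma_conj, ← star_toComplex, toComplex_sigma_chiInt, star_chi3]

lemma haveCharacters : HaveCharacters fundamentalRep lam3 lam4 := by
  refine ⟨fun g => classOf (idx g), fun g => ⟨?_, ?_, ?_⟩⟩
  · rw [← galoisRep_id, unitaryChar_galoisRep, RingHom.id_apply, toComplex_chiInt]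
  · rw [lam3, unitaryChar_galoisRep, toComplex_sigma_chiInt]
  · rw [lam4, unitaryChar_galoisRep, RingHom.comp_apply, toComplex_sigma_conj_chiInt]

/-! ### Irreducibility and Schur's lemma -/

/-- The entries are integers, which every ring endomorphism fixes. -/
lemma galoisRep_gen_zero : (galoisRep τ hτ (gen 0)).1 = genA := by
  refine (isDouble_galoisRep_of_isDouble (isDouble_genU 0)).left_unique (V := genA) ?_
  have h := isDouble_genU 0
  have h2 : τ.mapMatrix (genInt 0) = genInt 0 := by
    ext i j : 1
    fin_cases i <;> fin_cases j <;> simp [genInt, map_ofNat τ 2]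
  rw [h2]
  exact h

lemma galoisRep_gen_one : (galoisRep τ hτ (gen 1)).1 = genE := by
  refine (isDouble_galoisRep_of_isDouble (isDouble_genU 1)).left_unique (V := genE) ?_
  have h := isDouble_genU 1
  have h2 : τ.mapMatrix (genInt 1) = genInt 1 := by
    ext i j : 1
    fin_cases i <;> fin_cases j <;> simp [genInt, map_ofNat τ 2]
  rw [h2]
  exact h

/-- A matrix which commutes with `genA` and `genE` is scalar. -/
lemma eq_smul_one_of_commute {M : Matrix (Fin 3) (Fin 3) ℂ} (hA : genA * M = M * genA)
    (hE : genE * M = M * genE) : M = M 0 0 • (1 : Matrix (Fin 3) (Fin 3) ℂ) := by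
  have hA' := fun i j => congrFun (congrFun hA i) j
  have hE' := fun i j => congrFun (congrFun hE i) j
  simp [Fin.forall_fin_succ, Matrix.mul_apply, Fin.sum_univ_three, genA, genE] at hA' hE'
  obtain ⟨⟨h1, h2, h3⟩, ⟨h4, h5, h6⟩, -⟩ := hA'
  -- Commuting with `genA` makes the matrix circulant; commuting with `genE` gives x = -x for the
  -- two off-diagonal entries of the first row.
  obtain ⟨⟨e1, e2⟩, -⟩ := hE'
  have e3 := self_eq_neg.1 e1
  have e4 := self_eq_neg.1 e2
  ext i j
  fin_cases i <;> fin_cases j <;> simp [h1, h2, h3, h4, h5, h6, e3, e4]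

/-- For u in an invariant subspace, u + Eu = 2u₀e₀. Cyclic shifts first make u₀ nonzero and
afterwards produce the other basis vectors from e₀. -/
lemma isIrreducible_of_gen {lam : sigma360 →* unitaryGroup (Fin 3) ℂ}
    (hA : (lam (gen 0)).1 = genA) (hE : (lam (gen 1)).1 = genE) :
    (unitaryRep lam).IsIrreducible := by
  have key (W : Subrepresentation (unitaryRep lam)) {v : EuclideanSpace ℂ (Fin 3)}
      (hv : v ∈ W.toSubmodule) (hv0 : v ≠ 0) : W = ⊤ := by
    have hA' {u : EuclideanSpace ℂ (Fin 3)} (hu : u ∈ W.toSubmodule) :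
        !₂[u 1, u 2, u 0] ∈ W.toSubmodule := by
      convert W.apply_mem_toSubmodule (gen 0) hu using 1
      ext i
      fin_cases i <;>
        simp [unitaryRep, hA, genA, Matrix.mulVec, dotProduct, Fin.sum_univ_three]
    have hE' {u : EuclideanSpace ℂ (Fin 3)} (hu : u ∈ W.toSubmodule) :
        !₂[u 0, -u 1, -u 2] ∈ W.toSubmodule := by
      convert W.apply_mem_toSubmodule (gen 1) hu using 1
      ext i
      fin_cases i <;>
        simp [unitaryRep, hE, genE, Matrix.mulVec, dotProduct, Fin.sum_univ_three]
    have h1 {u : EuclideanSpace ℂ (Fin 3)} (hu : u ∈ W.toSubmodule) (hu0 : u 0 ≠ 0) :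
        W = ⊤ := by
      have h2 : !₂[(1 : ℂ), 0, 0] ∈ W.toSubmodule := by
        convert W.toSubmodule.smul_mem (2 * u 0)⁻¹ (W.toSubmodule.add_mem hu (hE' hu)) using 1
        ext i
        fin_cases i <;> simp
        field_simp
        norm_num
      have h3 : !₂[(0 : ℂ), 0, 1] ∈ W.toSubmodule := by simpa using hA' h2
      have h4 : !₂[(0 : ℂ), 1, 0] ∈ W.toSubmodule := by simpa using hA' h3
      apply Subrepresentation.toSubmodule_injective
      refine eq_top_iff.2 fun w _ => ?_
      have h5 : w = w 0 • !₂[(1 : ℂ), 0, 0] + w 1 • !₂[(0 : ℂ), 1, 0] +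
          w 2 • !₂[(0 : ℂ), 0, 1] := by
        ext i
        fin_cases i <;> simp
      rw [h5]
      exact add_mem (add_mem (Submodule.smul_mem _ _ h2) (Submodule.smul_mem _ _ h4))
        (Submodule.smul_mem _ _ h3)
    by_cases h20 : v 0 = 0
    · by_cases h21 : v 1 = 0
      · refine h1 (hA' (hA' hv)) ?_
        intro h
        apply hv0
        ext i
        fin_cases i
        exacts [h20, h21, by simpa using h]
      · exact h1 (hA' hv) (by simpa using h21)
    · exact h1 hv h20
  have : Nontrivial (Subrepresentation (unitaryRep lam)) := by
    refine ⟨⊥, ⊤, fun h => ?_⟩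
    have h1 := congrArg Subrepresentation.toSubmodule h
    exact bot_ne_top (α := Submodule ℂ (EuclideanSpace ℂ (Fin 3))) h1
  refine { eq_bot_or_eq_top := fun W => ?_ }
  by_cases h : W.toSubmodule = ⊥
  · exact Or.inl (Subrepresentation.toSubmodule_injective h)
  · obtain ⟨v, hv, hv0⟩ := Submodule.exists_mem_ne_zero_of_ne_bot h
    exact Or.inr (key W hv hv0)

/-! ### Haar averages of matrix entries -/

instance isProbabilityMeasure_unitaryHaar (q : ℕ) : IsProbabilityMeasure (unitaryHaar q) :=
  ⟨Measure.haarMeasure_self⟩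

instance isMulLeftInvariant_unitaryHaar (q : ℕ) : (unitaryHaar q).IsMulLeftInvariant :=
  inferInstanceAs (Measure.haarMeasure ⊤).IsMulLeftInvariant

lemma integrable_unitaryHaar {q : ℕ} {f : unitaryGroup (Fin q) ℂ → ℂ} (hf : Continuous f) :
    Integrable f (unitaryHaar q) :=
  hf.integrable_of_hasCompactSupport (HasCompactSupport.of_compactSpace f)

lemma continuous_entry {q : ℕ} (i j : Fin q) :
    Continuous fun U : unitaryGroup (Fin q) ℂ => U.1 i j :=
  (continuous_apply_apply i j).comp continuous_subtype_val

/-- For fixed j, l the integrals form a matrix in i, k. Left invariance makes it commute with all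
unitary matrices, hence it is scalar, and its trace is given by orthonormality of columns. -/
lemma integral_entry_mul_star (i j k l : Fin 3) :
    ∫ U : unitaryGroup (Fin 3) ℂ, U.1 i j * star (U.1 k l) ∂(unitaryHaar 3) =
      if i = k ∧ j = l then 1 / 3 else 0 := by
  have hint (i k : Fin 3) : Integrable (fun U : unitaryGroup (Fin 3) ℂ =>
      U.1 i j * star (U.1 k l)) (unitaryHaar 3) :=
    integrable_unitaryHaar ((continuous_entry i j).mul (continuous_entry k l).star)
  let P : Matrix (Fin 3) (Fin 3) ℂ := Matrix.of fun i k =>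
    ∫ U : unitaryGroup (Fin 3) ℂ, U.1 i j * star (U.1 k l) ∂(unitaryHaar 3)
  have hP (V : unitaryGroup (Fin 3) ℂ) : V.1 * P = P * V.1 := by
    have h1 : P = V.1 * P * star V.1 := by
      ext i k
      have hint' (a b : Fin 3) : Integrable (fun U : unitaryGroup (Fin 3) ℂ =>
          V.1 i b * U.1 b j * (star (V.1 k a) * star (U.1 a l))) (unitaryHaar 3) := by
        convert (hint b a).const_mul (V.1 i b * star (V.1 k a)) using 2
        ring
      change ∫ U : unitaryGroup (Fin 3) ℂ, U.1 i j * star (U.1 k l) ∂(unitaryHaar 3) = _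
      rw [← integral_mul_left_eq_self _ V]
      simp only [Matrix.mul_apply, Submonoid.coe_mul, Matrix.star_apply, Finset.sum_mul,
        Finset.mul_sum, star_sum, star_mul']
      rw [integral_finsetSum _ fun a _ => integrable_finsetSum _ fun b _ => hint' a b]
      refine Finset.sum_congr rfl fun a _ => ?_
      rw [integral_finsetSum _ fun b _ => hint' a b]
      refine Finset.sum_congr rfl fun b _ => ?_
      rw [show P b a = ∫ U : unitaryGroup (Fin 3) ℂ,
        U.1 b j * star (U.1 a l) ∂(unitaryHaar 3) from rfl,
        ← integral_const_mul, ← integral_mul_const]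
      congr 1
      ext U
      ring
    conv_rhs => rw [h1]
    rw [mul_assoc, Unitary.coe_star_mul_self, mul_one]
  have h2 := eq_smul_one_of_commute (hP ⟨genA, genA_mem⟩) (hP ⟨genE, genE_mem⟩)
  have h3 : P.trace = if j = l then 1 else 0 := by
    have h4 (U : unitaryGroup (Fin 3) ℂ) : ∑ i, U.1 i j * star (U.1 i l) =
        if j = l then 1 else 0 := by
      have h5 := congrFun (congrFun (Unitary.coe_star_mul_self U) l) j
      rw [Matrix.mul_apply, Matrix.one_apply] at h5
      simp only [Matrix.star_apply] at h5
      rw [show (if j = l then (1 : ℂ) else 0) = if l = j then 1 else 0 by simp only [eq_comm], ← h5]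
      exact Finset.sum_congr rfl fun i _ => mul_comm _ _
    rw [Matrix.trace]
    change ∑ i, ∫ U : unitaryGroup (Fin 3) ℂ, U.1 i j * star (U.1 i l) ∂(unitaryHaar 3) = _
    rw [← integral_finsetSum _ fun i _ => hint i i]
    simp only [h4, integral_const, probReal_univ, one_smul]
  have h4 : P 0 0 * 3 = if j = l then 1 else 0 := by
    rw [← h3, h2]
    simp
  have h5 := congrFun (congrFun h2 i) k
  change ∫ U : unitaryGroup (Fin 3) ℂ, U.1 i j * star (U.1 k l) ∂(unitaryHaar 3) = _ at h5
  rw [h5, Matrix.smul_apply, Matrix.one_apply, smul_eq_mul]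
  by_cases hik : i = k <;> by_cases hjl : j = l <;> simp [hik, hjl] at h4 ⊢
  · linear_combination h4 / 3
  · exact h4

/-! ### Sums over the group -/

/-- The sizes of the conjugacy classes, where the two classes with `χ₂ = 0` are united. -/
def classCard : Fin 17 → ℕ :=
  ![1, 1, 1, 45, 45, 45, 240, 0, 90, 90, 90, 72, 72, 72, 72, 72, 72]

lemma sum_classOf_idx {R : Type*} [Semiring R] (φ : Fin 17 → R) :
    ∑ g : sigma360, φ (classOf (idx g)) = ∑ k, (classCard k : R) * φ k := by
  rw [show ∑ g : sigma360, φ (classOf (idx g)) = ∑ x : Index, φ (classOf x) from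
    Equiv.sum_comp eltEquiv.symm fun x => φ (classOf x),
    ← Finset.sum_fiberwise' Finset.univ classOf φ]
  refine Finset.sum_congr rfl fun k _ => ?_
  rw [Finset.sum_const, card_classOf, nsmul_eq_mul]
  rfl

lemma unitaryChar_inv {G : Type*} [Group G] {m : ℕ} (lam : G →* unitaryGroup (Fin m) ℂ) (g : G) :
    unitaryChar lam g⁻¹ = star (unitaryChar lam g) := by
  rw [unitaryChar, unitaryChar, map_inv, ← Matrix.trace_conjTranspose]
  rfl

lemma trace_matOp {ι : Type*} [Fintype ι] [DecidableEq ι] (A : Matrix ι ι ℂ) :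
    LinearMap.trace ℂ _ (matOp A) = A.trace := by
  rw [matOp, Matrix.toEuclideanLin_eq_toLin_orthonormal, LinearMap.trace_eq_matrix_trace ℂ
    (EuclideanSpace.basisFun ι ℂ).toBasis, LinearMap.toMatrix_toLin]

lemma character_unitaryRep {G : Type*} [Group G] {m : ℕ} (lam : G →* unitaryGroup (Fin m) ℂ) :
    (unitaryRep lam).character = unitaryChar lam := by
  ext g
  exact trace_matOp _

/-! ### The adjoint representation -/

/-- The action of a unitary representation on matrices by conjugation. -/
def conjRep {G : Type*} [Group G] {m : ℕ} (lam : G →* unitaryGroup (Fin m) ℂ) :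
    Representation ℂ G (Matrix (Fin m) (Fin m) ℂ) where
  toFun g := LinearMap.mulLeft ℂ (lam g).1 ∘ₗ LinearMap.mulRight ℂ (star (lam g).1)
  map_one' := by
    ext1 X
    simp
  map_mul' g h := by
    refine LinearMap.ext fun X => ?_
    simp [mul_assoc]

lemma conjRep_apply {G : Type*} [Group G] {m : ℕ} (lam : G →* unitaryGroup (Fin m) ℂ) (g : G)
    (X : Matrix (Fin m) (Fin m) ℂ) : conjRep lam g X = (lam g).1 * X * star (lam g).1 := by
  simp [conjRep, mul_assoc]

lemma mul_single_mul_star_apply {m : ℕ} (M : Matrix (Fin m) (Fin m) ℂ) (a b c d : Fin m) :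
    (M * Matrix.single a b (1 : ℂ) * star M) c d = M c a * star (M d b) := by
  rw [Matrix.mul_apply, Finset.sum_eq_single b]
  · rw [Matrix.mul_single_apply_same, mul_one, Matrix.star_apply]
  · intro e _ he
    rw [Matrix.mul_single_apply_of_ne _ _ _ _ _ he, zero_mul]
  · simp

lemma character_conjRep {G : Type*} [Group G] {m : ℕ} (lam : G →* unitaryGroup (Fin m) ℂ)
    (g : G) : (conjRep lam).character g = unitaryChar lam g * star (unitaryChar lam g) := by
  rw [Representation.character,
    LinearMap.trace_eq_matrix_trace ℂ (Matrix.stdBasis ℂ (Fin m) (Fin m)), Matrix.trace,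
    Fintype.sum_prod_type, unitaryChar, Matrix.trace, star_sum, Finset.sum_mul_sum]
  refine Finset.sum_congr rfl fun i _ => Finset.sum_congr rfl fun j _ => ?_
  rw [Matrix.diag_apply, LinearMap.toMatrix_apply, Matrix.stdBasis_eq_single, conjRep_apply]
  exact mul_single_mul_star_apply _ i j i j

/-- The sum of `|χ₂|² |χ₃|²` over the group. -/
lemma sum_chiInt : ∑ k, (classCard k : CycInt) *
    (sigma (chiInt k) * conj (sigma (chiInt k)) * (chiInt k * conj (chiInt k))) = 1080 := by
  decide +kernel

/-- The intertwining maps between the adjoint representations are multiples of the trace. -/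
lemma finrank_intertwiningMap_conjRep {lam : sigma360 →* unitaryGroup (Fin 3) ℂ}
    (h : ∀ g, unitaryChar lam g * star (unitaryChar lam g) =
      toComplex (sigma (chiInt (classOf (idx g))) * conj (sigma (chiInt (classOf (idx g)))))) :
    Module.finrank ℂ (Representation.IntertwiningMap (conjRep fundamentalRep) (conjRep lam)) =
      1 := by
  have hc : (Nat.card sigma360 : ℂ) = 1080 := by
    rw [card_sigma360]
    norm_num
  have : Invertible (Nat.card sigma360 : ℂ) := invertibleOfNonzero (by rw [hc]; norm_num)
  have h1 := Representation.card_inv_mul_sum_char_mul_char_eq_finrank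
    (conjRep fundamentalRep) (conjRep lam)
  obtain ⟨φ, hφ⟩ : ∃ φ : Fin 17 → CycInt, ∀ k, φ k =
    sigma (chiInt k) * conj (sigma (chiInt k)) * (chiInt k * conj (chiInt k)) := ⟨_, fun _ => rfl⟩
  have h2 (g : sigma360) : (conjRep lam).character g * (conjRep fundamentalRep).character g⁻¹ =
      toComplex (φ (classOf (idx g))) := by
    rw [character_conjRep, character_conjRep, unitaryChar_inv, star_star, h, ← galoisRep_id,
      unitaryChar_galoisRep, RingHom.id_apply, star_toComplex, ← map_mul, ← map_mul,
      mul_comm (conj (chiInt _)), hφ]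
  have h4 := sum_chiInt
  simp only [← hφ] at h4
  rw [← sum_classOf_idx] at h4
  have h5 := congrArg toComplex h4
  rw [map_sum, map_ofNat] at h5
  rw [Finset.sum_congr rfl fun g _ => h2 g, h5, hc] at h1
  have h3 : (Module.finrank ℂ
      (Representation.IntertwiningMap (conjRep fundamentalRep) (conjRep lam)) : ℂ) = 1 := by
    rw [← h1]
    norm_num
  exact_mod_cast h3

lemma unitaryChar_lam3_mul_star (g : sigma360) : unitaryChar lam3 g * star (unitaryChar lam3 g) =
    toComplex (sigma (chiInt (classOf (idx g))) * conj (sigma (chiInt (classOf (idx g))))) := by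
  rw [lam3, unitaryChar_galoisRep, star_toComplex, ← map_mul]

lemma unitaryChar_lam4_mul_star (g : sigma360) : unitaryChar lam4 g * star (unitaryChar lam4 g) =
    toComplex (sigma (chiInt (classOf (idx g))) * conj (sigma (chiInt (classOf (idx g))))) := by
  have h (z : CycInt) : conj (conj z) = z := by
    ext <;> simp [conj]
  rw [lam4, unitaryChar_galoisRep, star_toComplex, ← map_mul, RingHom.comp_apply, sigma_conj, h,
    mul_comm]

/-- A representation with the adjoint representation of which the adjoint representation of the
fundamental representation has only the trivial constituent in common. -/
structure IsTwisting (lam : sigma360 →* unitaryGroup (Fin 3) ℂ) : Prop where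
  genA_eq : (lam (gen 0)).1 = genA
  genE_eq : (lam (gen 1)).1 = genE
  char_eq : ∀ g, unitaryChar lam g * star (unitaryChar lam g) =
    toComplex (sigma (chiInt (classOf (idx g))) * conj (sigma (chiInt (classOf (idx g)))))

lemma isTwisting_lam3 : IsTwisting lam3 :=
  ⟨galoisRep_gen_zero, galoisRep_gen_one, unitaryChar_lam3_mul_star⟩

lemma isTwisting_lam4 : IsTwisting lam4 :=
  ⟨galoisRep_gen_zero, galoisRep_gen_one, unitaryChar_lam4_mul_star⟩

namespace IsTwisting

variable {lam : sigma360 →* unitaryGroup (Fin 3) ℂ}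

/-- The space of intertwining maps is one-dimensional and X ↦ tr X · 1 is a nonzero element of it.
-/
lemma exists_eq_trace_smul (hlam : IsTwisting lam)
    (Φ : Matrix (Fin 3) (Fin 3) ℂ →ₗ[ℂ] Matrix (Fin 3) (Fin 3) ℂ)
    (hΦ : ∀ (g : sigma360) X, Φ (g.1.1 * X * star g.1.1) = (lam g).1 * Φ X * star (lam g).1) :
    ∃ c : ℂ, ∀ X, Φ X = (c * X.trace) • 1 := by
  have h1 := finrank_intertwiningMap_conjRep hlam.char_eq
  let Φ₁ : Representation.IntertwiningMap (conjRep fundamentalRep) (conjRep lam) :=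
    Φ.intertwiningMap_of_isIntertwiningMap _ _ fun g X => by
      rw [conjRep_apply, conjRep_apply]
      exact hΦ g X
  let Φ₀ : Representation.IntertwiningMap (conjRep fundamentalRep) (conjRep lam) :=
    ((Matrix.traceLinearMap (Fin 3) ℂ ℂ).smulRight
      (1 : Matrix (Fin 3) (Fin 3) ℂ)).intertwiningMap_of_isIntertwiningMap _ _ fun g X => by
        rw [conjRep_apply, conjRep_apply]
        simp [Matrix.trace_mul_cycle]
  have h0 : Φ₀ ≠ 0 := by
    intro h
    have h2 : Φ₀ 1 = 0 := by rw [h]; rfl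
    have h3 : Φ₀ 1 = (3 : ℂ) • (1 : Matrix (Fin 3) (Fin 3) ℂ) := by
      change (1 : Matrix (Fin 3) (Fin 3) ℂ).trace • (1 : Matrix (Fin 3) (Fin 3) ℂ) = _
      simp
    rw [h3] at h2
    have h4 := congrFun (congrFun h2 0) 0
    simp at h4
  obtain ⟨c, hc⟩ := (finrank_eq_one_iff_of_nonzero' Φ₀ h0).1 h1 Φ₁
  refine ⟨c, fun X => ?_⟩
  have h2 : Φ₁ X = c • Φ₀ X := by rw [← hc]; rfl
  rw [mul_smul]
  exact h2

/-- With matrix units B = E_{jl} and Y = E_{pr}, the map X ↦ Σ tr(X g B g*) λ(g) Y λ(g)* is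
equivariant, so it is c·tr X·1. The sum in question is its (p, r) entry at X = E_{ki}. -/
lemma sum_entry_mul (hlam : IsTwisting lam) (i j k l p r : Fin 3) :
    ∑ g : sigma360, (g.1.1 i j * star (g.1.1 k l)) * ((lam g).1 p p * star ((lam g).1 r r)) =
      if (i = k ∧ j = l) ∧ p = r then 120 else 0 := by
  let B : Matrix (Fin 3) (Fin 3) ℂ := Matrix.single j l 1
  let Y : Matrix (Fin 3) (Fin 3) ℂ := Matrix.single p r 1
  let Φ : Matrix (Fin 3) (Fin 3) ℂ →ₗ[ℂ] Matrix (Fin 3) (Fin 3) ℂ :=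
    ∑ g : sigma360, ((Matrix.traceLinearMap (Fin 3) ℂ ℂ) ∘ₗ
      LinearMap.mulRight ℂ (g.1.1 * B * star g.1.1)).smulRight ((lam g).1 * Y * star (lam g).1)
  have hΦ (X : Matrix (Fin 3) (Fin 3) ℂ) : Φ X = ∑ g : sigma360,
      (X * (g.1.1 * B * star g.1.1)).trace • ((lam g).1 * Y * star (lam g).1) := by
    simp [Φ, mul_assoc]
  have hinv (g : sigma360) : star g.1.1 * g.1.1 = 1 := Unitary.coe_star_mul_self g.1
  have hinv' (g : sigma360) : star (lam g).1 * (lam g).1 = 1 := Unitary.coe_star_mul_self (lam g)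
  obtain ⟨c, hc⟩ := hlam.exists_eq_trace_smul Φ fun h X => by
    -- Equivariance comes from substituting hg for g in the sum.
    rw [hΦ, hΦ, ← Equiv.sum_comp (Equiv.mulLeft h), Finset.mul_sum, Finset.sum_mul]
    refine Finset.sum_congr rfl fun g _ => ?_
    rw [Equiv.coe_mulLeft, map_mul]
    change ((h.1.1 * X * star h.1.1) * (h.1.1 * g.1.1 * B * star (h.1.1 * g.1.1))).trace •
      ((lam h).1 * (lam g).1 * Y * star ((lam h).1 * (lam g).1)) = _
    rw [mul_smul_comm, smul_mul_assoc]
    congr 1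
    · rw [show (h.1.1 * X * star h.1.1) * (h.1.1 * g.1.1 * B * star (h.1.1 * g.1.1)) =
        h.1.1 * (X * (star h.1.1 * h.1.1) * (g.1.1 * B * star g.1.1)) * star h.1.1 by
          simp only [star_mul, mul_assoc], Matrix.trace_mul_cycle, ← mul_assoc, hinv, one_mul,
        mul_one]
    · simp only [star_mul, mul_assoc]
  -- The trace of the value at X = 1 determines the constant; 120 is 1080/9.
  have h1 : c * 9 = 1080 * (B.trace * Y.trace) := by
    have h2 := congrArg Matrix.trace (hc 1)
    have h3 (g : sigma360) : ((1 : Matrix (Fin 3) (Fin 3) ℂ) * (g.1.1 * B * star g.1.1)).trace •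
        ((lam g).1 * Y * star (lam g).1).trace = B.trace * Y.trace := by
      rw [one_mul, Matrix.trace_mul_cycle, hinv, one_mul, Matrix.trace_mul_cycle, hinv', one_mul,
        smul_eq_mul]
    have h4 : Fintype.card sigma360 = 1080 := by
      rw [← Nat.card_eq_fintype_card, card_sigma360]
    rw [hΦ, Matrix.trace_sum, Finset.sum_congr rfl fun g _ => (Matrix.trace_smul _ _).trans (h3 g),
      Finset.sum_const, Finset.card_univ, h4, nsmul_eq_mul, Matrix.trace_smul, Matrix.trace_one,
      smul_eq_mul] at h2
    simp at h2
    linear_combination -h2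
  have h2 := congrFun (congrFun (hc (Matrix.single k i 1)) p) r
  rw [hΦ, Matrix.sum_apply] at h2
  have h3 (g : sigma360) : ((Matrix.single k i (1 : ℂ) * (g.1.1 * B * star g.1.1)).trace •
      ((lam g).1 * Y * star (lam g).1)) p r =
        (g.1.1 i j * star (g.1.1 k l)) * ((lam g).1 p p * star ((lam g).1 r r)) := by
    rw [Matrix.smul_apply, mul_single_mul_star_apply, Matrix.trace_single_mul,
      mul_single_mul_star_apply, one_smul, smul_eq_mul]
  rw [Finset.sum_congr rfl fun g _ => h3 g] at h2
  rw [h2, Matrix.smul_apply, Matrix.one_apply, smul_eq_mul]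
  by_cases hik : i = k <;> by_cases hjl : j = l <;> by_cases hpr : p = r <;>
    simp [B, Y, hik, hjl, hpr, Matrix.trace_single_eq_of_ne, Ne.symm] at h1 ⊢
  · linear_combination h1 / 9
  · exact h1

lemma isTwistedUnitaryGroup (hlam : IsTwisting lam) : IsTwistedUnitaryGroup 1 sigma360 lam := by
  refine ⟨inferInstance, fun x y => ?_⟩
  have h1 (U : Matrix (Fin 3) (Fin 3) ℂ) : balancedPower 1 U x y =
      U (x 0).1 (y 0).1 * star (U (x 0).2 (y 0).2) := by
    simp [balancedPower]
  simp only [h1]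
  rw [integral_entry_mul_star, finsum_eq_sum_of_fintype, card_sigma360]
  have h2 (g : sigma360) : ((‖unitaryChar lam g‖ ^ 2 / (1080 : ℕ) : ℝ) : ℂ) *
      (g.1.1 (x 0).1 (y 0).1 * star (g.1.1 (x 0).2 (y 0).2)) = ∑ p, ∑ r, (1 / 1080 : ℂ) *
        ((g.1.1 (x 0).1 (y 0).1 * star (g.1.1 (x 0).2 (y 0).2)) *
          ((lam g).1 p p * star ((lam g).1 r r))) := by
    -- Only the three terms with p = r survive the sum over the group, and 3·120/1080 = 1/3 is the
    -- Haar value.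
    have h3 : ((‖unitaryChar lam g‖ ^ 2 : ℝ) : ℂ) =
        ∑ p, ∑ r, (lam g).1 p p * star ((lam g).1 r r) := by
      rw [← Finset.sum_mul_sum, ← star_sum]
      change _ = unitaryChar lam g * star (unitaryChar lam g)
      rw [Complex.star_def, Complex.mul_conj']
      push_cast
      rfl
    rw [Complex.ofReal_div, h3]
    simp only [← Finset.mul_sum]
    push_cast
    ring
  have h3 : ∀ p r, ∑ g : sigma360, (1 / 1080 : ℂ) *
      ((g.1.1 (x 0).1 (y 0).1 * star (g.1.1 (x 0).2 (y 0).2)) *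
        ((lam g).1 p p * star ((lam g).1 r r))) =
      1 / 1080 * if ((x 0).1 = (x 0).2 ∧ (y 0).1 = (y 0).2) ∧ p = r then 120 else 0 := by
    intro p r
    rw [← Finset.mul_sum, hlam.sum_entry_mul]
  rw [Finset.sum_congr rfl fun g _ => h2 g, Finset.sum_comm,
    Finset.sum_congr rfl fun p _ => Finset.sum_comm]
  simp only [h3]
  by_cases h : (x 0).1 = (x 0).2 ∧ (y 0).1 = (y 0).2
  · simp [h]
    norm_num
  · simp [h]

end IsTwisting

/-! ### Tensor powers -/

/-- The tensor product of matrices. -/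
def tensorMat {q n : ℕ} (u : Fin n → Matrix (Fin q) (Fin q) ℂ) :
    Matrix (Fin n → Fin q) (Fin n → Fin q) ℂ :=
  Matrix.of fun x y => ∏ i, u i (x i) (y i)

section TensorMat

variable {q n : ℕ}

lemma tensorMat_mul (u v : Fin n → Matrix (Fin q) (Fin q) ℂ) :
    tensorMat u * tensorMat v = tensorMat (u * v) := by
  ext x y
  simp only [tensorMat, Matrix.mul_apply, Matrix.of_apply, Pi.mul_apply, Finset.prod_univ_sum,
    ← Finset.prod_mul_distrib, Fintype.piFinset_univ]

lemma tensorMat_one : tensorMat (1 : Fin n → Matrix (Fin q) (Fin q) ℂ) = 1 := by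
  ext x y
  simp only [tensorMat, Matrix.of_apply, Pi.one_apply, Matrix.one_apply]
  rw [Finset.prod_ite_zero]
  simp [funext_iff]

lemma star_tensorMat (u : Fin n → Matrix (Fin q) (Fin q) ℂ) :
    star (tensorMat u) = tensorMat (star u) := by
  ext x y
  simp [tensorMat, Matrix.star_apply]

lemma trace_tensorMat (u : Fin n → Matrix (Fin q) (Fin q) ℂ) :
    (tensorMat u).trace = ∏ i, (u i).trace := by
  simp only [tensorMat, Matrix.trace, Matrix.diag_apply, Matrix.of_apply, Finset.prod_univ_sum,
    Fintype.piFinset_univ]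

/-- The matrix of `U^{⊗ n}`. -/
def powMat (n : ℕ) (U : unitaryGroup (Fin q) ℂ) : Matrix (Fin n → Fin q) (Fin n → Fin q) ℂ :=
  tensorMat fun _ => U.1

lemma gatePower_eq (U : unitaryGroup (Fin q) ℂ) : gatePower n U = matOp (powMat n U) := rfl

lemma powMat_mul (U V : unitaryGroup (Fin q) ℂ) :
    powMat n (U * V) = powMat n U * powMat n V := by
  rw [powMat, powMat, powMat, tensorMat_mul]
  rfl

lemma powMat_one : powMat n (1 : unitaryGroup (Fin q) ℂ) = 1 := tensorMat_one

lemma powMat_mul_star_self (U : unitaryGroup (Fin q) ℂ) : powMat n U * star (powMat n U) = 1 := by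
  rw [powMat, star_tensorMat, tensorMat_mul, ← tensorMat_one]
  congr 1
  ext1 i
  exact Unitary.coe_mul_star_self U

lemma matOp_mul {ι : Type*} [Fintype ι] [DecidableEq ι] (A B : Matrix ι ι ℂ) :
    matOp (A * B) = matOp A * matOp B := by
  ext v i
  simp [Matrix.mulVec_mulVec]

lemma matOp_smul_one {ι : Type*} [Fintype ι] [DecidableEq ι] (c : ℂ) (v : EuclideanSpace ℂ ι) :
    matOp (c • (1 : Matrix ι ι ℂ)) v = c • v := by
  ext i
  simp

lemma matOp_one {ι : Type*} [Fintype ι] [DecidableEq ι] : matOp (1 : Matrix ι ι ℂ) = 1 := by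
  ext v i
  simp

end TensorMat

/-- The tensor powers of the fundamental representation. -/
def powRep (n : ℕ) : Representation ℂ sigma360 (QuditSpace 3 n) where
  toFun g := gatePower n g.1
  map_one' := by
    rw [gatePower_eq, OneMemClass.coe_one, powMat_one, matOp_one]
  map_mul' g h := by
    rw [gatePower_eq, gatePower_eq, gatePower_eq, Subgroup.coe_mul, powMat_mul, matOp_mul]

lemma character_powRep (n : ℕ) (g : sigma360) :
    (powRep n).character g = unitaryChar fundamentalRep g ^ n := by
  have h : (powRep n).character g = (powMat n g.1).trace := trace_matOp _
  rw [h, powMat, trace_tensorMat]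
  simp [unitaryChar, fundamentalRep]

/-- The image of a nonzero intertwining map transforms in `lam`. -/
lemma transformsIn_range {lam : sigma360 →* unitaryGroup (Fin 3) ℂ}
    (hlam : (unitaryRep lam).IsIrreducible) {n : ℕ}
    {f : Representation.IntertwiningMap (unitaryRep lam) (powRep n)} (hf : f ≠ 0) :
    TransformsIn lam (LinearMap.range f.toLinearMap) := by
  have hinj : Function.Injective f.toLinearMap :=
    (Representation.IsIrreducible.injective_or_eq_zero f).resolve_right hf
  refine ⟨LinearEquiv.ofInjective f.toLinearMap hinj, fun g v => ?_⟩
  rw [LinearEquiv.ofInjective_apply, LinearEquiv.ofInjective_apply]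
  exact LinearMap.congr_fun (f.isIntertwining' g) v

/-- A code which transforms in `lam` is the image of an injective intertwining map. -/
lemma TransformsIn.exists_intertwiningMap {lam : sigma360 →* unitaryGroup (Fin 3) ℂ} {n : ℕ}
    {C : Submodule ℂ (QuditSpace 3 n)} (hC : TransformsIn lam C) :
    ∃ f : Representation.IntertwiningMap (unitaryRep lam) (powRep n),
      f ≠ 0 ∧ Function.Injective f.toLinearMap ∧ LinearMap.range f.toLinearMap = C := by
  obtain ⟨e, he⟩ := hC
  have hinj : Function.Injective (C.subtype ∘ₗ e.toLinearMap) :=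
    C.subtype_injective.comp e.injective
  refine ⟨⟨C.subtype ∘ₗ e.toLinearMap, fun g => LinearMap.ext fun v => he g v⟩, fun h => ?_, hinj, ?_⟩
  · have h1 : C.subtype ∘ₗ e.toLinearMap = 0 := congrArg (fun f => f.toLinearMap) h
    have h2 : (!₂[(1 : ℂ), 0, 0] : EuclideanSpace ℂ (Fin 3)) = 0 := by
      apply hinj
      rw [h1]
      simp
    have h3 := congrArg (fun v : EuclideanSpace ℂ (Fin 3) => v 0) h2
    simp at h3
  · change LinearMap.range (C.subtype ∘ₗ e.toLinearMap) = C
    rw [LinearMap.range_comp, LinearEquiv.range, Submodule.map_top, Submodule.range_subtype]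

lemma exists_transformsIn_iff {lam : sigma360 →* unitaryGroup (Fin 3) ℂ}
    (hlam : (unitaryRep lam).IsIrreducible) (n : ℕ) :
    (∃ C : Submodule ℂ (QuditSpace 3 n), TransformsIn lam C) ↔
      Module.finrank ℂ (Representation.IntertwiningMap (unitaryRep lam) (powRep n)) ≠ 0 := by
  constructor
  · rintro ⟨C, hC⟩
    obtain ⟨f, hf, -⟩ := hC.exists_intertwiningMap
    have : Nontrivial (Representation.IntertwiningMap (unitaryRep lam) (powRep n)) := ⟨f, 0, hf⟩
    exact Module.finrank_pos.ne'
  · intro h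
    have := Module.nontrivial_of_finrank_pos (Nat.pos_of_ne_zero h)
    obtain ⟨f, hf⟩ := exists_ne
      (0 : Representation.IntertwiningMap (unitaryRep lam) (powRep n))
    exact ⟨_, transformsIn_range hlam hf⟩

/-- Nonzero multiples of one intertwining map all have the same image. -/
lemma existsUnique_transformsIn {lam : sigma360 →* unitaryGroup (Fin 3) ℂ}
    (hlam : (unitaryRep lam).IsIrreducible) {n : ℕ}
    (h : Module.finrank ℂ (Representation.IntertwiningMap (unitaryRep lam) (powRep n)) = 1) :
    ∃! C : Submodule ℂ (QuditSpace 3 n), TransformsIn lam C := by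
  obtain ⟨f, hf, h1⟩ := finrank_eq_one_iff'.1 h
  refine ⟨_, transformsIn_range hlam hf, fun C hC => ?_⟩
  obtain ⟨f', hf', -, rfl⟩ := hC.exists_intertwiningMap
  obtain ⟨c, rfl⟩ := h1 f'
  have hc : c ≠ 0 := by
    rintro rfl
    exact hf' (zero_smul _ _)
  exact LinearMap.range_smul f.toLinearMap c hc

/-! ### Multiplicities in the tensor powers -/

/-- The sequence `(-μ)ⁿ (1 + μ) + (1 + μ)ⁿ (-μ)`, that is, `1` for `n = 0` and the negative of the
`n - 1`-st Lucas number otherwise. -/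
def negLucas : ℕ → ℤ
  | 0 => 1
  | 1 => -2
  | n + 2 => negLucas (n + 1) + negLucas n

lemma negLucas_eq (n : ℕ) : q 0 (-1) 0 0 ^ n * q 1 1 0 0 + q 1 1 0 0 ^ n * q 0 (-1) 0 0 =
    (negLucas n : CycInt) := by
  induction n using Nat.twoStepInduction with
  | zero => decide +kernel
  | one => decide +kernel
  | more n h1 h2 =>
    -- -μ and 1 + μ are the two roots of x² = x + 1, which is the recursion.
    have e1 : q 0 (-1) 0 0 * q 0 (-1) 0 0 = q 0 (-1) 0 0 + 1 := by decide +kernel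
    have e2 : q 1 1 0 0 * q 1 1 0 0 = q 1 1 0 0 + 1 := by decide +kernel
    rw [negLucas, Int.cast_add, ← h1, ← h2]
    linear_combination q 0 (-1) 0 0 ^ n * q 1 1 0 0 * e1 + q 1 1 0 0 ^ n * q 0 (-1) 0 0 * e2

/-- The value of `1080` times the multiplicity of `χ₃` or `χ₄` in the `n`-th tensor power. -/
def multSum (n : ℕ) : ℤ := 9 * 3 ^ n - 135 * (-1) ^ n + 270 + 216 * negLucas n

/-- The real factors of the values of `χ₂`. -/
def chiReal : Fin 17 → CycInt :=
  ![3, 3, 3, -1, -1, -1, 0, 0, 1, 1, 1, q 0 (-1) 0 0, q 0 (-1) 0 0, q 0 (-1) 0 0, q 1 1 0 0,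
    q 1 1 0 0, q 1 1 0 0]

/-- The exponents of `ω` in the values of `χ₂`. -/
def chiExp : Fin 17 → ℕ := ![0, 2, 1, 0, 2, 1, 0, 0, 0, 2, 1, 1, 0, 2, 2, 1, 0]

lemma chiInt_eq (k : Fin 17) : chiInt k = q 0 0 1 0 ^ chiExp k * chiReal k := by
  revert k
  decide +kernel

lemma sum_chiReal (n : ℕ) (hn : n ≠ 0) :
    ∑ k, (classCard k : CycInt) * (chiReal k ^ n * sigma (chiReal k)) = (multSum n : CycInt) := by
  have h1 : sigma (q 0 (-1) 0 0) = q 1 1 0 0 := by decide +kernel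
  have h2 : sigma (q 1 1 0 0) = q 0 (-1) 0 0 := by decide +kernel
  simp [Fin.sum_univ_succ, classCard, chiReal, h1, h2, map_ofNat sigma 3, hn, multSum,
    ← negLucas_eq]
  ring

/-- The powers of ω cancel because n + 2 is divisible by 3. For χ₄ below the divisible number is n +
1, and the same real expression remains, so one multiplicity formula serves both. -/
lemma chiInt_pow_mul_conj_sigma {n : ℕ} (hn : n ≡ 1 [MOD 3]) (k : Fin 17) :
    chiInt k ^ n * conj (sigma (chiInt k)) = chiReal k ^ n * sigma (chiReal k) := by
  have h1 : conj (sigma (chiReal k)) = sigma (chiReal k) := by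
    revert k
    decide +kernel
  have h2 : conj (sigma (q 0 0 1 0)) = q 0 0 1 0 ^ 2 := by decide +kernel
  have h3 : q 0 0 1 0 ^ 3 = 1 := by decide +kernel
  have h4 : chiExp k * n + 2 * chiExp k = 3 * (chiExp k * (n / 3 + 1)) := by
    have := Nat.div_add_mod n 3
    rw [hn] at this
    conv_lhs => rw [← this]
    ring
  rw [chiInt_eq, map_mul, map_mul, map_pow, map_pow, h1, h2, mul_pow]
  have h5 : (q 0 0 1 0 ^ chiExp k) ^ n * (q 0 0 1 0 ^ 2) ^ chiExp k = 1 := by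
    rw [← pow_mul, ← pow_mul, ← pow_add, h4, pow_mul, h3, one_pow]
  linear_combination chiReal k ^ n * sigma (chiReal k) * h5

lemma chiInt_pow_mul_sigma {n : ℕ} (hn : n ≡ 2 [MOD 3]) (k : Fin 17) :
    chiInt k ^ n * sigma (chiInt k) = chiReal k ^ n * sigma (chiReal k) := by
  have h2 : sigma (q 0 0 1 0) = q 0 0 1 0 := by decide +kernel
  have h3 : q 0 0 1 0 ^ 3 = 1 := by decide +kernel
  have h4 : chiExp k * n + chiExp k = 3 * (chiExp k * (n / 3 + 1)) := by
    have := Nat.div_add_mod n 3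
    rw [hn] at this
    conv_lhs => rw [← this]
    ring
  rw [chiInt_eq, map_mul, map_pow, h2, mul_pow]
  have h5 : (q 0 0 1 0 ^ chiExp k) ^ n * q 0 0 1 0 ^ chiExp k = 1 := by
    rw [← pow_mul, ← pow_add, h4, pow_mul, h3, one_pow]
  linear_combination chiReal k ^ n * sigma (chiReal k) * h5

lemma finrank_mul_card {lam : sigma360 →* unitaryGroup (Fin 3) ℂ} {n : ℕ} (hn : n ≠ 0)
    (h : ∀ g, unitaryChar fundamentalRep g ^ n * star (unitaryChar lam g) =
      toComplex (chiReal (classOf (idx g)) ^ n * sigma (chiReal (classOf (idx g))))) :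
    1080 * (Module.finrank ℂ (Representation.IntertwiningMap (unitaryRep lam) (powRep n)) : ℤ) =
      multSum n := by
  have hc : (Nat.card sigma360 : ℂ) = 1080 := by
    rw [card_sigma360]
    norm_num
  have : Invertible (Nat.card sigma360 : ℂ) := invertibleOfNonzero (by rw [hc]; norm_num)
  have h1 := Representation.card_inv_mul_sum_char_mul_char_eq_finrank (unitaryRep lam) (powRep n)
  have h2 (g : sigma360) : (powRep n).character g * (unitaryRep lam).character g⁻¹ =
      toComplex (chiReal (classOf (idx g)) ^ n * sigma (chiReal (classOf (idx g)))) := by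
    rw [character_powRep, character_unitaryRep, unitaryChar_inv, h]
  have h3 := sum_chiReal n hn
  rw [← sum_classOf_idx fun k => chiReal k ^ n * sigma (chiReal k)] at h3
  have h4 := congrArg toComplex h3
  rw [map_sum, map_intCast] at h4
  rw [Finset.sum_congr rfl fun g _ => h2 g, h4, hc] at h1
  have h5 : (1080 * (Module.finrank ℂ
      (Representation.IntertwiningMap (unitaryRep lam) (powRep n)) : ℂ)) = multSum n := by
    rw [← h1]
    field_simp
  exact_mod_cast h5

lemma finrank_lam3 {n : ℕ} (hn : n ≡ 1 [MOD 3]) :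
    1080 * (Module.finrank ℂ (Representation.IntertwiningMap (unitaryRep lam3) (powRep n)) : ℤ) =
      multSum n := by
  refine finrank_mul_card (by rintro rfl; simp [Nat.ModEq] at hn) fun g => ?_
  rw [← chiInt_pow_mul_conj_sigma hn, lam3, ← galoisRep_id, unitaryChar_galoisRep,
    unitaryChar_galoisRep, star_toComplex, map_mul, map_pow, RingHom.id_apply]

lemma finrank_lam4 {n : ℕ} (hn : n ≡ 2 [MOD 3]) :
    1080 * (Module.finrank ℂ (Representation.IntertwiningMap (unitaryRep lam4) (powRep n)) : ℤ) =
      multSum n := by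
  have h (z : CycInt) : conj (conj z) = z := by
    ext <;> simp [conj]
  refine finrank_mul_card (by rintro rfl; simp [Nat.ModEq] at hn) fun g => ?_
  rw [← chiInt_pow_mul_sigma hn, lam4, ← galoisRep_id, unitaryChar_galoisRep,
    unitaryChar_galoisRep, star_toComplex, map_mul, map_pow, RingHom.id_apply, RingHom.comp_apply,
    sigma_conj, h]

lemma multSum_pos {n : ℕ} (hn : 5 ≤ n) : 0 < multSum n := by
  -- The Lucas numbers at most double at each step while 3ⁿ triples, so the bound valid at n = 5
  -- persists.
  have h1 : 0 ≤ -negLucas n ∧ -negLucas n ≤ -negLucas (n + 1) ∧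
      -negLucas (n + 1) ≤ 2 * -negLucas n ∧
      216 * -negLucas n + 135 < 9 * 3 ^ n := by
    induction n, hn using Nat.le_induction with
    | base => decide
    | succ n _ ih =>
      rw [show negLucas (n + 1 + 1) = negLucas (n + 1) + negLucas n from rfl, pow_succ]
      omega
  have h2 : (-1 : ℤ) ^ n ≤ 1 := by
    rcases neg_one_pow_eq_or ℤ n with h | h <;> rw [h] <;> norm_num
  rw [multSum]
  omega

/-! ### The action of the center -/

lemma exists_center : ∃ z : sigma360, IsDouble z.1.1 ((2 : CycInt) • diagonal fun _ => q 0 0 1 0) := by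
  refine ⟨elt (1, 0, 0, 0), ?_⟩
  rw [← show code (1, 0, 0, 0) = (2 : CycInt) • diagonal fun _ => q 0 0 1 0 by decide +kernel]
  exact isDouble_elt _

lemma IsDouble.eq_smul_one {U : Matrix (Fin 3) (Fin 3) ℂ} {a : CycInt}
    (h : IsDouble U ((2 : CycInt) • diagonal fun _ => a)) : U = toComplex a • 1 := by
  apply smul_right_injective _ (two_ne_zero' ℂ)
  change (2 : ℂ) • U = (2 : ℂ) • toComplex a • 1
  rw [IsDouble, matC_two_smul] at h
  rw [h, Matrix.smul_one_eq_diagonal]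
  congr 1
  simp [Matrix.diagonal_map]

/-- The central element ω acts on the n-th tensor power by ωⁿ and in the Galois conjugate by τ(ω).
This is what fixes n modulo 3. -/
lemma zeta3_pow_eq_of_transformsIn {hτ : ∀ z, τ (conj z) = conj (τ z)} {n : ℕ}
    {C : Submodule ℂ (QuditSpace 3 n)} (hC : TransformsIn (galoisRep τ hτ) C) :
    zeta 3 ^ n = toComplex (τ (q 0 0 1 0)) := by
  obtain ⟨z, hz⟩ := exists_center
  have hz' := (isDouble_galoisRep_of_isDouble (τ := τ) (hτ := hτ) hz)
  rw [show τ.mapMatrix ((2 : CycInt) • diagonal fun _ : Fin 3 => q 0 0 1 0) =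
    (2 : CycInt) • diagonal fun _ => τ (q 0 0 1 0) by
      ext i j : 1
      simp [Matrix.diagonal_apply]
      split_ifs <;> simp [map_ofNat τ 2]] at hz'
  have h1 := hz.eq_smul_one
  have h2 := hz'.eq_smul_one
  have h3 : toComplex (q 0 0 1 0) = zeta 3 := by simp [toComplex_q]
  rw [h3] at h1
  obtain ⟨e, he⟩ := hC
  have h4 : powMat n z.1 = zeta 3 ^ n • 1 := by
    rw [powMat, h1, ← tensorMat_one]
    ext x y
    simp [tensorMat, Finset.prod_mul_distrib]
  let v : EuclideanSpace ℂ (Fin 3) := !₂[1, 0, 0]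
  have hv : v ≠ 0 := fun h => by simpa [v] using congrArg (fun v : EuclideanSpace ℂ (Fin 3) => v 0) h
  have h5 := he z v
  rw [gatePower_eq, h4] at h5
  have h6 : unitaryRep (galoisRep τ hτ) z v = toComplex (τ (q 0 0 1 0)) • v := by
    change matOp (galoisRep τ hτ z).1 v = _
    rw [h2, matOp_smul_one]
  rw [h6, map_smul, matOp_smul_one, Submodule.coe_smul] at h5
  have h7 : (e v : QuditSpace 3 n) ≠ 0 := by
    simpa using hv
  exact (smul_left_injective ℂ h7 h5).symm

lemma zeta3_pow_inj {m n : ℕ} (h : zeta 3 ^ m = zeta 3 ^ n) : m ≡ n [MOD 3] := by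
  have h1 : IsPrimitiveRoot (zeta 3) 3 := Complex.isPrimitiveRoot_exp 3 (by norm_num)
  have h3 : zeta 3 ^ 3 = 1 := h1.pow_eq_one
  exact h1.pow_inj (Nat.mod_lt _ (by norm_num)) (Nat.mod_lt _ (by norm_num))
    (by rw [← pow_eq_pow_mod m h3, ← pow_eq_pow_mod n h3, h])

lemma exists_transformsIn_lam3_iff (n : ℕ) :
    (∃ C : Submodule ℂ (QuditSpace 3 n), TransformsIn lam3 C) ↔ n ≡ 1 [MOD 3] ∧ 7 ≤ n := by
  have hirr : (unitaryRep lam3).IsIrreducible :=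
    isIrreducible_of_gen galoisRep_gen_zero galoisRep_gen_one
  constructor
  · intro h
    have hn : n ≡ 1 [MOD 3] := by
      obtain ⟨C, hC⟩ := h
      apply zeta3_pow_inj
      rw [zeta3_pow_eq_of_transformsIn hC, show sigma (q 0 0 1 0) = q 0 0 1 0 by decide +kernel]
      simp [toComplex_q]
    refine ⟨hn, ?_⟩
    by_contra hn7
    rw [exists_transformsIn_iff hirr] at h
    have h1 := finrank_lam3 hn
    have h2 : n = 1 ∨ n = 4 := by
      rw [Nat.ModEq] at hn
      omega
    rcases h2 with rfl | rfl
    · rw [show multSum 1 = 0 by decide] at h1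
      omega
    · rw [show multSum 4 = 0 by decide] at h1
      omega
  · rintro ⟨hn, hn7⟩
    rw [exists_transformsIn_iff hirr]
    have h1 := finrank_lam3 hn
    have h2 := multSum_pos (show 5 ≤ n by omega)
    omega

lemma exists_transformsIn_lam4_iff (n : ℕ) :
    (∃ C : Submodule ℂ (QuditSpace 3 n), TransformsIn lam4 C) ↔ n ≡ 2 [MOD 3] ∧ 5 ≤ n := by
  have hirr : (unitaryRep lam4).IsIrreducible :=
    isIrreducible_of_gen galoisRep_gen_zero galoisRep_gen_one
  constructor
  · intro h
    have hn : n ≡ 2 [MOD 3] := by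
      obtain ⟨C, hC⟩ := h
      apply zeta3_pow_inj
      rw [zeta3_pow_eq_of_transformsIn hC,
        show (sigma.comp conj) (q 0 0 1 0) = q 0 0 1 0 ^ 2 by decide +kernel, map_pow]
      simp [toComplex_q]
    refine ⟨hn, ?_⟩
    by_contra hn5
    rw [exists_transformsIn_iff hirr] at h
    have h1 := finrank_lam4 hn
    have h2 : n = 2 := by
      rw [Nat.ModEq] at hn
      omega
    subst h2
    rw [show multSum 2 = 0 by decide] at h1
    omega
  · rintro ⟨hn, hn5⟩
    rw [exists_transformsIn_iff hirr]
    have h1 := finrank_lam4 hn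
    have h2 := multSum_pos hn5
    omega

lemma existsUnique_transformsIn_lam4 :
    ∃! C : Submodule ℂ (QuditSpace 3 5), TransformsIn lam4 C := by
  refine existsUnique_transformsIn (isIrreducible_of_gen galoisRep_gen_zero galoisRep_gen_one) ?_
  have h1 := finrank_lam4 (n := 5) rfl
  rw [show multSum 5 = 1080 by decide] at h1
  unfold lam4 at h1
  omega

/-! ### Compression of operators to a code -/

lemma matOp_injective {ι : Type*} [Fintype ι] [DecidableEq ι] :
    Function.Injective (matOp : Matrix ι ι ℂ → _) :=
  Matrix.toEuclideanLin.injective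

lemma adjoint_matOp {ι : Type*} [Fintype ι] [DecidableEq ι] (A : Matrix ι ι ℂ) :
    LinearMap.adjoint (matOp A) = matOp (star A) :=
  (Matrix.toEuclideanLin_conjTranspose_eq_adjoint A).symm

/-- The matrix of `f† T f`. -/
def compress {m n : ℕ} (f : EuclideanSpace ℂ (Fin m) →ₗ[ℂ] QuditSpace 3 n) :
    Matrix (Fin n → Fin 3) (Fin n → Fin 3) ℂ →ₗ[ℂ] Matrix (Fin m) (Fin m) ℂ :=
  Matrix.toEuclideanLin.symm.toLinearMap ∘ₗ
    LinearMap.lcomp ℂ _ f ∘ₗ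
      LinearMap.compRight ℂ (LinearMap.adjoint f) ∘ₗ Matrix.toEuclideanLin.toLinearMap

lemma matOp_compress {m n : ℕ} (f : EuclideanSpace ℂ (Fin m) →ₗ[ℂ] QuditSpace 3 n)
    (T : Matrix (Fin n → Fin 3) (Fin n → Fin 3) ℂ) :
    matOp (compress f T) = LinearMap.adjoint f ∘ₗ matOp T ∘ₗ f :=
  Matrix.toEuclideanLin.apply_symm_apply _

lemma inner_compress {m n : ℕ} (f : EuclideanSpace ℂ (Fin m) →ₗ[ℂ] QuditSpace 3 n)
    (T : Matrix (Fin n → Fin 3) (Fin n → Fin 3) ℂ) (v w : EuclideanSpace ℂ (Fin m)) :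
    inner ℂ (f v) (matOp T (f w)) = inner ℂ v (matOp (compress f T) w) := by
  rw [matOp_compress, LinearMap.comp_apply, LinearMap.adjoint_inner_right, LinearMap.comp_apply]

section Intertwining

variable {lam : sigma360 →* unitaryGroup (Fin 3) ℂ} {n : ℕ}
  {f : EuclideanSpace ℂ (Fin 3) →ₗ[ℂ] QuditSpace 3 n}

/-- The intertwining relation at g⁻¹ moves the right factor past `f`; its adjoint moves the left
factor past f†. -/
lemma compress_conj (hf : ∀ (g : sigma360) v, gatePower n g.1 (f v) = f (unitaryRep lam g v))
    (g : sigma360) (T : Matrix (Fin n → Fin 3) (Fin n → Fin 3) ℂ) :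
    compress f (powMat n g.1 * T * star (powMat n g.1)) =
      (lam g).1 * compress f T * star (lam g).1 := by
  have h1 : matOp (star (powMat n g.1)) ∘ₗ f = f ∘ₗ matOp (star (lam g).1) := by
    have h2 : star (powMat n g.1) = powMat n (g⁻¹ : sigma360).1 := star_tensorMat _
    have h3 : star (lam g).1 = (lam g⁻¹).1 := by
      rw [map_inv]
      rfl
    rw [h2, h3]
    exact LinearMap.ext fun v => hf g⁻¹ v
  have h2 := congrArg LinearMap.adjoint h1
  rw [LinearMap.adjoint_comp, LinearMap.adjoint_comp, adjoint_matOp, adjoint_matOp, star_star,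
    star_star] at h2
  apply matOp_injective
  rw [matOp_compress, matOp_mul, matOp_mul, matOp_mul, matOp_mul, matOp_compress]
  simp only [Module.End.mul_eq_comp, LinearMap.comp_assoc]
  rw [h1, ← LinearMap.comp_assoc, h2, LinearMap.comp_assoc]

/-- By Schur's lemma f†f is a scalar c, positive since `f` is injective; the isometry is f/√c. -/
lemma exists_isometry (hlam : IsTwisting lam)
    (hf : ∀ (g : sigma360) v, gatePower n g.1 (f v) = f (unitaryRep lam g v))
    (hinj : Function.Injective f) :
    ∃ V : EuclideanSpace ℂ (Fin 3) →ₗᵢ[ℂ] QuditSpace 3 n,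
      LinearMap.range V.toLinearMap = LinearMap.range f ∧
        ∀ g : sigma360, Implements V (gatePower n g.1) (lam g) := by
  have hcomm (g : sigma360) : (lam g).1 * compress f 1 = compress f 1 * (lam g).1 := by
    have h1 := compress_conj hf g 1
    rw [mul_one, powMat_mul_star_self] at h1
    have h2 : star (lam g).1 * (lam g).1 = 1 := Unitary.coe_star_mul_self (lam g)
    conv_rhs => rw [h1, mul_assoc, h2, mul_one]
  have h1 := eq_smul_one_of_commute (hlam.genA_eq ▸ hcomm (gen 0)) (hlam.genE_eq ▸ hcomm (gen 1))
  set c := compress f 1 0 0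
  have hnorm (v : EuclideanSpace ℂ (Fin 3)) : ‖f v‖ ^ 2 = c.re * ‖v‖ ^ 2 := by
    have h2 := inner_compress f 1 v v
    rw [matOp_one, Module.End.one_apply, h1, matOp_smul_one, inner_smul_right,
      inner_self_eq_norm_sq_to_K, inner_self_eq_norm_sq_to_K] at h2
    have h3 : ((‖f v‖ ^ 2 : ℝ) : ℂ) = c * ((‖v‖ ^ 2 : ℝ) : ℂ) := by
      push_cast
      exact h2
    have h4 := congrArg Complex.re h3
    rwa [Complex.re_mul_ofReal, Complex.ofReal_re] at h4
  have hc : 0 < c.re := by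
    let v : EuclideanSpace ℂ (Fin 3) := !₂[1, 0, 0]
    have hv : v ≠ 0 := fun h => by
      simpa [v] using congrArg (fun v : EuclideanSpace ℂ (Fin 3) => v 0) h
    have hfv : f v ≠ 0 := fun h => hv (hinj (h.trans f.map_zero.symm))
    have h2 : 0 < c.re * ‖v‖ ^ 2 := by
      rw [← hnorm]
      positivity
    exact pos_of_mul_pos_left h2 (by positivity)
  have hs : 0 < √c.re := Real.sqrt_pos.2 hc
  have hs' : (((√c.re)⁻¹ : ℝ) : ℂ) ≠ 0 := by
    exact_mod_cast (inv_pos.2 hs).ne'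
  refine ⟨⟨(((√c.re)⁻¹ : ℝ) : ℂ) • f, fun v => ?_⟩, LinearMap.range_smul f _ hs', fun g v => ?_⟩
  · rw [LinearMap.smul_apply, norm_smul, Complex.norm_real, Real.norm_of_nonneg (inv_pos.2 hs).le,
      inv_mul_eq_iff_eq_mul₀ hs.ne', ← sq_eq_sq₀ (norm_nonneg _) (by positivity), hnorm, mul_pow,
      Real.sq_sqrt hc.le]
  · change gatePower n g.1 ((((√c.re)⁻¹ : ℝ) : ℂ) • f v) =
      (((√c.re)⁻¹ : ℝ) : ℂ) • f (unitaryRep lam g v)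
    rw [LinearMap.map_smul, hf]

end Intertwining

/-! ### Errors on a single qutrit -/

/-- The operator on `n` qutrits which acts on the qutrit `i` by `X`. -/
def siteMat {n : ℕ} (i : Fin n) : Matrix (Fin 3) (Fin 3) ℂ →ₗ[ℂ]
    Matrix (Fin n → Fin 3) (Fin n → Fin 3) ℂ where
  toFun X := Matrix.of fun x y => if ∀ j, j ≠ i → x j = y j then X (x i) (y i) else 0
  map_add' X Y := by
    ext x y
    simp only [Matrix.of_apply, Matrix.add_apply]
    split_ifs <;> simp
  map_smul' c X := by
    ext x y
    simp

lemma siteMat_eq {n : ℕ} (i : Fin n) (X : Matrix (Fin 3) (Fin 3) ℂ) :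
    siteMat i X = tensorMat (Function.update 1 i X) := by
  ext x y
  change (if ∀ j, j ≠ i → x j = y j then X (x i) (y i) else 0) =
    ∏ j, Function.update (1 : Fin n → Matrix (Fin 3) (Fin 3) ℂ) i X j (x j) (y j)
  rw [← Finset.mul_prod_erase _ _ (Finset.mem_univ i), Function.update_self,
    Finset.prod_congr rfl fun j hj => by
      rw [Function.update_of_ne (Finset.ne_of_mem_erase hj), Pi.one_apply, Matrix.one_apply],
    Finset.prod_ite_zero]
  simp

lemma siteMat_conj {n : ℕ} (i : Fin n) (U : unitaryGroup (Fin 3) ℂ)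
    (X : Matrix (Fin 3) (Fin 3) ℂ) :
    siteMat i (U.1 * X * star U.1) = powMat n U * siteMat i X * star (powMat n U) := by
  rw [siteMat_eq, siteMat_eq, powMat, star_tensorMat, tensorMat_mul, tensorMat_mul]
  congr 1
  ext1 j
  by_cases h : j = i
  · subst h
    simp
  · have h1 : U.1 * star U.1 = 1 := Unitary.coe_mul_star_self U
    simp [h, h1]

lemma localError_empty {n : ℕ} (A : Matrix ((∅ : Finset (Fin n)) → Fin 3)
    ((∅ : Finset (Fin n)) → Fin 3) ℂ) :
    localError ∅ A = matOp (A default default • (1 : Matrix (Fin n → Fin 3) (Fin n → Fin 3) ℂ)) := by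
  rw [localError]
  congr 1
  ext x y
  rw [Matrix.of_apply, Matrix.smul_apply, Matrix.one_apply, smul_eq_mul, mul_ite, mul_one,
    mul_zero]
  refine if_congr ?_ (congrArg₂ A (Subsingleton.elim _ _) (Subsingleton.elim _ _)) rfl
  simp [funext_iff]

lemma localError_singleton {n : ℕ} (i : Fin n)
    (A : Matrix (({i} : Finset (Fin n)) → Fin 3) (({i} : Finset (Fin n)) → Fin 3) ℂ) :
    localError {i} A = matOp (siteMat i (Matrix.of fun a b => A (fun _ => a) fun _ => b)) := by
  rw [localError]
  congr 1
  ext x y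
  change _ = if ∀ j, j ≠ i → x j = y j then A (fun _ => x i) (fun _ => y i) else 0
  have h (z : Fin n → Fin 3) : (fun j : ({i} : Finset (Fin n)) => z j) = fun _ => z i := by
    ext1 j
    rw [Finset.mem_singleton.1 j.2]
  rw [Matrix.of_apply, h, h]
  simp only [Finset.mem_singleton, ne_eq]

lemma detectsErrors_range {lam : sigma360 →* unitaryGroup (Fin 3) ℂ} (hlam : IsTwisting lam)
    {n : ℕ} (V : EuclideanSpace ℂ (Fin 3) →ₗᵢ[ℂ] QuditSpace 3 n)
    (hV : ∀ g : sigma360, Implements V (gatePower n g.1) (lam g)) :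
    DetectsErrors (LinearMap.range V.toLinearMap) 1 := by
  intro S A hS
  rcases Nat.le_one_iff_eq_zero_or_eq_one.1 hS with hS | hS
  · obtain rfl := Finset.card_eq_zero.1 hS
    refine ⟨A default default, fun ψ _ φ _ => ?_⟩
    rw [localError_empty, matOp_smul_one, inner_smul_right]
  · obtain ⟨i, rfl⟩ := Finset.card_eq_one.1 hS
    -- The map X ↦ V†X_iV intertwines Ad f with Ad λ, hence compresses every error on the qutrit i
    -- to a scalar.
    obtain ⟨c, hc⟩ := hlam.exists_eq_trace_smul (compress V.toLinearMap ∘ₗ siteMat i)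
      fun g X => by
        rw [LinearMap.comp_apply, siteMat_conj]
        exact compress_conj hV g _
    rw [localError_singleton]
    refine ⟨c * (Matrix.of fun a b => A (fun _ => a) fun _ => b).trace, ?_⟩
    rintro _ ⟨v, rfl⟩ _ ⟨w, rfl⟩
    rw [inner_compress, ← LinearMap.comp_apply (compress _), hc, matOp_smul_one, inner_smul_right]
    congr 1
    exact (V.inner_map_map v w).symm

/-! ### Implementation of the whole group -/

lemma norm_matOp_unitary {m : ℕ} (U : unitaryGroup (Fin m) ℂ) (v : EuclideanSpace ℂ (Fin m)) :
    ‖matOp U.1 v‖ = ‖v‖ := by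
  have h : star U.1 * U.1 = 1 := Unitary.coe_star_mul_self U
  have h1 : inner ℂ (matOp U.1 v) (matOp U.1 v) = inner ℂ v v := by
    rw [← LinearMap.adjoint_inner_right, adjoint_matOp, ← LinearMap.comp_apply,
      ← Module.End.mul_eq_comp, ← matOp_mul, h, matOp_one, Module.End.one_apply]
  rw [inner_self_eq_norm_sq_to_K, inner_self_eq_norm_sq_to_K] at h1
  norm_cast at h1
  exact (sq_eq_sq₀ (norm_nonneg _) (norm_nonneg _)).1 h1

/-- A unitary change of the logical basis. -/
lemma hasTransversalGroup_range {lam : sigma360 →* unitaryGroup (Fin 3) ℂ} {n : ℕ}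
    (V : EuclideanSpace ℂ (Fin 3) →ₗᵢ[ℂ] QuditSpace 3 n)
    (hV : ∀ g : sigma360, Implements V (gatePower n g.1) (lam g)) (T : unitaryGroup (Fin 3) ℂ)
    (hT : ∀ x, ∃ g, T * lam g = genU x * T) :
    HasTransversalGroup sigma360 (LinearMap.range V.toLinearMap) := by
  -- Since T λ(·) T⁻¹ reaches all generators, it reaches the whole group; V T⁻¹ is the encoding for
  -- the new logical basis.
  have hle : sigma360 ≤ ((MulAut.conj T).toMonoidHom.comp lam).range := by
    refine sigma360_eq_closure.le.trans ((Subgroup.closure_le _).2 ?_)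
    rintro _ ⟨x, rfl⟩
    obtain ⟨g, hg⟩ := hT x
    exact ⟨g, mul_inv_eq_of_eq_mul hg⟩
  have hsurj : Function.Surjective (matOp (T⁻¹).1) := fun v => ⟨matOp T.1 v, by
    rw [← LinearMap.comp_apply, ← Module.End.mul_eq_comp, ← matOp_mul]
    have h : (T⁻¹).1 * T.1 = 1 := Unitary.coe_star_mul_self T
    rw [h, matOp_one, Module.End.one_apply]⟩
  refine ⟨V.comp ⟨matOp (T⁻¹).1, norm_matOp_unitary T⁻¹⟩, ?_, fun L hL => ?_⟩
  · exact LinearMap.range_comp_of_range_eq_top _ (LinearMap.range_eq_top.2 hsurj)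
  · obtain ⟨g, rfl⟩ := hle hL
    refine ⟨g.1, g.2, fun v => ?_⟩
    change gatePower n g.1 (V (matOp (T⁻¹).1 v)) =
      V (matOp (T⁻¹).1 (matOp (T * lam g * T⁻¹).1 v))
    rw [hV, ← LinearMap.comp_apply, ← LinearMap.comp_apply, ← Module.End.mul_eq_comp,
      ← Module.End.mul_eq_comp, ← matOp_mul, ← matOp_mul]
    congr 3
    exact congrArg Subtype.val (show lam g * T⁻¹ = T⁻¹ * (T * lam g * T⁻¹) by group)

/-- The unitary matrix is M/√k, so that `M` itself can have entries in ℤ[μ, ω] and the hypotheses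
can be decided. -/
lemma exists_unitary_conj {τ : CycInt →+* CycInt} {hτ : ∀ z, τ (conj z) = conj (τ z)} {k : ℕ}
    (hk : k ≠ 0) (M : Matrix (Fin 3) (Fin 3) CycInt)
    (hM : M * (conj.mapMatrix M)ᵀ = (k : CycInt) • (1 : Matrix (Fin 3) (Fin 3) CycInt))
    (h : ∀ x, ∃ y, M * τ.mapMatrix (code y) = genInt x * M) :
    ∃ T : unitaryGroup (Fin 3) ℂ, ∀ x, ∃ g, T * galoisRep τ hτ g = genU x * T := by
  have hs : ((√k : ℝ) : ℂ) * ((√k : ℝ) : ℂ) = k := by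
    rw [← Complex.ofReal_mul, Real.mul_self_sqrt (Nat.cast_nonneg k)]
    simp
  have hk' : (k : ℂ) ≠ 0 := Nat.cast_ne_zero.2 hk
  have hmem : (((√k : ℝ) : ℂ)⁻¹) • matC M ∈ unitaryGroup (Fin 3) ℂ := by
    have h1 : matC M * star (matC M) = (k : ℂ) • 1 := by
      rw [star_matC, ← map_mul, hM]
      refine Matrix.ext fun i j => ?_
      simp [Matrix.one_apply, apply_ite toComplex]
    rw [mem_unitaryGroup_iff, star_smul, smul_mul_smul, h1, smul_smul, star_inv₀,
      Complex.star_def, Complex.conj_ofReal, ← mul_inv, hs, inv_mul_cancel₀ hk', one_smul]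
  refine ⟨⟨_, hmem⟩, fun x => ?_⟩
  obtain ⟨y, hy⟩ := h x
  refine ⟨elt y, Subtype.ext ?_⟩
  change (((√k : ℝ) : ℂ)⁻¹) • matC M * (galoisRep τ hτ (elt y)).1 =
    (genU x).1 * (((√k : ℝ) : ℂ)⁻¹) • matC M
  rw [smul_mul_assoc, mul_smul_comm]
  congr 1
  apply smul_right_injective _ (two_ne_zero' ℂ)
  have h1 := isDouble_galoisRep_of_isDouble (τ := τ) (hτ := hτ) (isDouble_elt y)
  have h2 := isDouble_genU x
  have h3 := congrArg matC hy
  rw [IsDouble] at h1 h2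
  rw [map_mul, map_mul, ← h1, ← h2, mul_smul_comm, smul_mul_assoc] at h3
  exact h3

lemma exists_unitary_conj_lam3 :
    ∃ T : unitaryGroup (Fin 3) ℂ, ∀ x, ∃ g, T * lam3 g = genU x * T := by
  refine exists_unitary_conj (k := 2) two_ne_zero
    !![q (-1) (-1) (-1) 0, 0, 0; 0, -1, q 0 0 1 0; 0, q (-1) 0 (-1) 0, 1]
    (by decide +kernel) fun x => ⟨![(2, 2, 0, 9), (0, 1, 0, 0), (0, 2, 4, 13), (0, 2, 0, 0)] x, ?_⟩
  revert x
  decide +kernel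

lemma exists_unitary_conj_lam4 :
    ∃ T : unitaryGroup (Fin 3) ℂ, ∀ x, ∃ g, T * lam4 g = genU x * T := by
  -- Exchanging the last two coordinates undoes the Galois conjugation on `genE`, `genW` and `genZ`,
  -- and turns the square of `genA` into `genA`.
  refine exists_unitary_conj (k := 1) one_ne_zero !![1, 0, 0; 0, 0, 1; 0, 1, 0]
    (by decide +kernel) fun x => ⟨![(0, 0, 2, 0), (0, 1, 0, 0), (0, 0, 0, 1), (0, 0, 3, 0)] x, ?_⟩
  revert x
  decide +kernel

lemma IsTwisting.isTwistedCode {lam : sigma360 →* unitaryGroup (Fin 3) ℂ} (hlam : IsTwisting lam)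
    (h : ∃ T : unitaryGroup (Fin 3) ℂ, ∀ x, ∃ g, T * lam g = genU x * T) {n : ℕ}
    {C : Submodule ℂ (QuditSpace 3 n)} (hC : TransformsIn lam C) :
    IsTwistedCode 1 lam C ∧ HasTransversalGroup sigma360 C := by
  obtain ⟨T, hT⟩ := h
  obtain ⟨f, -, hinj, rfl⟩ := hC.exists_intertwiningMap
  obtain ⟨V, hVr, hV⟩ := exists_isometry hlam
    (fun g v => (LinearMap.congr_fun (f.isIntertwining' g) v).symm) hinj
  rw [← hVr]
  refine ⟨⟨?_, detectsErrors_range hlam V hV, V, rfl, hV⟩, hasTransversalGroup_range V hV T hT⟩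
  rw [LinearMap.finrank_range_of_inj V.injective, finrank_euclideanSpace_fin]

end

theorem mainTheorem5 :
    (Nat.card sigma360 = 1080 ∧ (∀ U ∈ sigma360, U.1.det = 1) ∧ commutator sigma360 = ⊤) ∧
    ∃ lam₃ lam₄ : sigma360 →* Matrix.unitaryGroup (Fin 3) ℂ,
      HaveCharacters fundamentalRep lam₃ lam₄ ∧
      (unitaryRep fundamentalRep).IsIrreducible ∧
      (unitaryRep lam₃).IsIrreducible ∧
      (unitaryRep lam₄).IsIrreducible ∧
      IsTwistedUnitaryGroup 1 sigma360 lam₃ ∧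
      IsTwistedUnitaryGroup 1 sigma360 lam₄ ∧
      (∀ (n : ℕ) (C : Submodule ℂ (QuditSpace 3 n)), TransformsIn lam₃ C →
        IsTwistedCode 1 lam₃ C ∧ HasTransversalGroup sigma360 C) ∧
      (∀ (n : ℕ) (C : Submodule ℂ (QuditSpace 3 n)), TransformsIn lam₄ C →
        IsTwistedCode 1 lam₄ C ∧ HasTransversalGroup sigma360 C) ∧
      (∀ n : ℕ, (∃ C : Submodule ℂ (QuditSpace 3 n), TransformsIn lam₃ C) ↔
        n ≡ 1 [MOD 3] ∧ 7 ≤ n) ∧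
      (∀ n : ℕ, (∃ C : Submodule ℂ (QuditSpace 3 n), TransformsIn lam₄ C) ↔
        n ≡ 2 [MOD 3] ∧ 5 ≤ n) ∧
      (∃! C : Submodule ℂ (QuditSpace 3 5), TransformsIn lam₄ C) := by
  refine ⟨⟨card_sigma360, fun U hU => det_eq_one hU, commutator_sigma360⟩, lam3, lam4,
    haveCharacters, ?_, isIrreducible_of_gen galoisRep_gen_zero galoisRep_gen_one,
    isIrreducible_of_gen galoisRep_gen_zero galoisRep_gen_one,
    isTwisting_lam3.isTwistedUnitaryGroup, isTwisting_lam4.isTwistedUnitaryGroup,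
    fun n C hC => isTwisting_lam3.isTwistedCode exists_unitary_conj_lam3 hC,
    fun n C hC => isTwisting_lam4.isTwistedCode exists_unitary_conj_lam4 hC,
    exists_transformsIn_lam3_iff, exists_transformsIn_lam4_iff, existsUnique_transformsIn_lam4⟩
  rw [← galoisRep_id]
  exact isIrreducible_of_gen galoisRep_gen_zero galoisRep_gen_one
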